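/- Identify $\mathbb{R}^4$ with the real quaternions via $x\mapsto \begin{pmatrix} x_0+ix_1 & x_2+ix_3\\ -x_2+ix_3 & x_0-ix_1\end{pmatrix}=x_0+x_1q_1+x_2q_2+x_3q_3$, and $\mathbb{R}^3$ with the span of $q_1,q_2,q_3$. Let $\sigma:\mathrm{SU}(2)\times\mathrm{SU}(2)\to\mathrm{SO}(4)$, $\sigma(p,q)x=pxq^{-1}$, and $\rho:\mathrm{SU}(2)\to\mathrm{SO}(3)$, $\rho(p)x=pxp^{-1}$, be the classical $2:1$ coverings. With $\tau=\frac12(1+\sqrt5)$ put $$A_1=\mathrm{diag}(1,-1,-1),\quad A_2=\mathrm{diag}(-1,1,-1),$$ $$R_3=\begin{pmatrix}0&-1&0\\0&0&-1\\1&0&0\end{pmatrix},\quad R_4=\begin{pmatrix}1&0&0\\0&0&-1\\0&1&0\end{pmatrix},\quad R_5=\frac12\begin{pmatrix}\tau-1&-\tau&1\\ \tau&1&\tau-1\\-1&\tau-1&\tau\end{pmatrix},$$ and let $V=\langle A_1,A_2\rangle$ (Klein four group), $T=\langle A_1,A_2,R_3\rangle$, $O=\langle A_2,R_3,R_4\rangle$,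 $I=\langle A_1,A_2,R_5\rangle$ (the rotation groups of the tetrahedron, octahedron and icosahedron) in $\mathrm{SO}(3)$. Put $H=\sigma(\rho^{-1}(V)\times\rho^{-1}(V))$, $G_6=\sigma(\rho^{-1}(T)\times\rho^{-1}(T))$, $G_8=\sigma(\rho^{-1}(O)\times\rho^{-1}(O))$, $G_{12}=\sigma(\rho^{-1}(I)\times\rho^{-1}(I))$. These groups act on $\mathbb{C}[x_0,x_1,x_2,x_3]$ by $(g f)(x)=f(g^{-1}x)$; let $\mathbb{C}[x_0,x_1,x_2,x_3]^G_j$ be the space of $G$-invariant homogeneous polynomials of degree $j$, and $Q=x_0^2+x_1^2+x_2^2+x_3^2$. 1. Each $G\in\{H,G_6,G_8,G_{12}\}$ is finite, and as formal power series $$\sum_{j\ge 0} t^j\dim\mathbb{C}[x_0,x_1,x_2,x_3]^G_j=\frac1{|G|}\sum_{g\in G}\frac1{\det(\mathrm{id}-g^{-1}t)}.$$ 2. This series is - for $H$: $1+t^2+5t^4+6t^6+15t^8+19t^{10}+35t^{12}+44t^{14}+O(t^{16})$, - for $G_6$: $1+t^2+t^4+2t^6+3t^8+3t^{10}+7t^{12}+8t^{14}+O(t^{16})$,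 - for $G_8$: $1+t^2+t^4+t^6+2t^8+2t^{10}+3t^{12}+3t^{14}+O(t^{16})$, - for $G_{12}$: $1+t^2+t^4+t^6+t^8+t^{10}+2t^{12}+2t^{14}+O(t^{16})$. 3. For $G\in\{H,G_6,G_8,G_{12}\}$ and every odd $j$ one has $\mathbb{C}[x_0,x_1,x_2,x_3]^G_j=0$. 4. Let $n\in\{6,8,12\}$. For every even $j<n$ the space $\mathbb{C}[x_0,x_1,x_2,x_3]^{G_n}_j$ is spanned by $Q^{j/2}$. In degree $n$ there is a polynomial $S_n$ such that $Q^{n/2}$ and $S_n$ form a basis of $\mathbb{C}[x_0,x_1,x_2,x_3]^{G_n}_n$; moreover $Q$ and $S_n$ are algebraically independent. -/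

import Mathlib

noncomputable section

namespace Bipolyhedral

/-- The group SU(2). -/
abbrev SU2 := Matrix.specialUnitaryGroup (Fin 2) ℂ

/-- The group SO(3). -/
abbrev SO3 := Matrix.specialOrthogonalGroup (Fin 3) ℝ

/-- The group SO(4). -/
abbrev SO4 := Matrix.specialOrthogonalGroup (Fin 4) ℝ

/-! ### The coverings `ρ : SU(2) → SO(3)` and `σ : SU(2) × SU(2) → SO(4)` -/

/-- The quaternion units `1, q₁, q₂, q₃` as complex `2 × 2` matrices. -/
def quatUnit : Fin 4 → Matrix (Fin 2) (Fin 2) ℂ :=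
  ![!![1, 0; 0, 1], !![Complex.I, 0; 0, -Complex.I], !![0, 1; -1, 0],
    !![0, Complex.I; Complex.I, 0]]

/-- The identification of `ℝ⁴` with the real quaternions: `x` goes to the matrix
`x₀ + x₁ q₁ + x₂ q₂ + x₃ q₃` with rows `(x₀ + i x₁, x₂ + i x₃)` and `(-x₂ + i x₃, x₀ - i x₁)`. -/
def quatMat (x : Fin 4 → ℝ) : Matrix (Fin 2) (Fin 2) ℂ :=
  ∑ k, (x k : ℂ) • quatUnit k

/-- The coordinates `x` of a quaternion `quatMat x`. -/
def quatCoord (m : Matrix (Fin 2) (Fin 2) ℂ) : Fin 4 → ℝ :=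
  ![(m 0 0).re, (m 0 0).im, (m 0 1).re, (m 0 1).im]

/-- The matrix of `x ↦ p x q⁻¹` on the quaternions `ℝ⁴`
(the inverse of a unitary matrix `q` is `star q`). -/
def sigmaMat (p q : Matrix (Fin 2) (Fin 2) ℂ) : Matrix (Fin 4) (Fin 4) ℝ :=
  Matrix.of fun i j => quatCoord (p * quatUnit j * star q) i

/-- The matrix of `x ↦ p x p⁻¹` on the imaginary quaternions `ℝ³ = ⟨q₁, q₂, q₃⟩`. -/
def rhoMat (p : Matrix (Fin 2) (Fin 2) ℂ) : Matrix (Fin 3) (Fin 3) ℝ :=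
  Matrix.of fun i j => quatCoord (p * quatUnit j.succ * star p) i.succ

theorem quatMat_eq (x : Fin 4 → ℝ) :
    quatMat x = !![x 0 + x 1 * Complex.I, x 2 + x 3 * Complex.I;
      -x 2 + x 3 * Complex.I, x 0 - x 1 * Complex.I] := by
  ext i j
  fin_cases i <;> fin_cases j <;> simp [quatMat, quatUnit, Fin.sum_univ_four, Matrix.sum_apply]
  ring

theorem quatCoord_quatMat (x : Fin 4 → ℝ) : quatCoord (quatMat x) = x := by
  rw [quatMat_eq]
  ext i
  fin_cases i <;> simp [quatCoord]

theorem exists_quatMat_of_mem {p : Matrix (Fin 2) (Fin 2) ℂ}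
    (hp : p ∈ Matrix.specialUnitaryGroup (Fin 2) ℂ) :
    ∃ x : Fin 4 → ℝ, p = quatMat x ∧ x 0 ^ 2 + x 1 ^ 2 + x 2 ^ 2 + x 3 ^ 2 = 1 := by
  obtain ⟨hu, hd⟩ := Matrix.mem_specialUnitaryGroup_iff.1 hp
  have h1 : p * star p = 1 := Matrix.mem_unitaryGroup_iff.1 hu
  have h2 : p.adjugate * p = 1 := by rw [Matrix.adjugate_mul, hd, one_smul]
  have h3 : star p = p.adjugate := by
    calc star p = p.adjugate * p * star p := by rw [h2, one_mul]
      _ = p.adjugate := by rw [mul_assoc, h1, mul_one]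
  rw [Matrix.adjugate_fin_two] at h3
  have e00 : p 1 1 = star (p 0 0) := by simpa using (congrFun (congrFun h3 0) 0).symm
  have e10 : p 1 0 = -star (p 0 1) := by
    have := congrFun (congrFun h3 1) 0
    simp at this
    simp [this]
  refine ⟨quatCoord p, ?_, ?_⟩
  · rw [quatMat_eq]
    ext i j
    fin_cases i <;> fin_cases j <;>
      simp [quatCoord, e00, e10, Complex.ext_iff]
  · rw [Matrix.det_fin_two, e00, e10] at hd
    have := congrArg Complex.re hd
    simp at this
    simp [quatCoord]
    linarith

theorem sigmaMat_quatMat (a b : Fin 4 → ℝ) :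
    sigmaMat (quatMat a) (quatMat b) =
      !![a 0, -a 1, -a 2, -a 3; a 1, a 0, -a 3, a 2; a 2, a 3, a 0, -a 1; a 3, -a 2, a 1, a 0] *
      !![b 0, b 1, b 2, b 3; -b 1, b 0, -b 3, b 2; -b 2, b 3, b 0, -b 1;
        -b 3, -b 2, b 1, b 0] := by
  simp only [sigmaMat, quatMat_eq, quatUnit, quatCoord]
  ext i j
  fin_cases i <;> fin_cases j <;>
    simp [Matrix.mul_apply, Fin.sum_univ_two, Fin.sum_univ_four, Matrix.star_apply] <;> ring

/-- `sigmaMat p q` is indeed the matrix of `x ↦ p x q⁻¹`. -/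
theorem quatMat_sigmaMat (a b x : Fin 4 → ℝ) :
    quatMat ((sigmaMat (quatMat a) (quatMat b)).mulVec x) =
      quatMat a * quatMat x * star (quatMat b) := by
  rw [sigmaMat_quatMat]
  simp only [quatMat_eq]
  ext i j
  fin_cases i <;> fin_cases j <;>
    simp [Matrix.mul_apply, Fin.sum_univ_two, Fin.sum_univ_four, Matrix.star_apply,
      Matrix.mulVec, dotProduct] <;> simp [Complex.ext_iff] <;> constructor <;> ring

theorem sigmaMat_mul {p q p' q' : Matrix (Fin 2) (Fin 2) ℂ}
    (hp : p ∈ Matrix.specialUnitaryGroup (Fin 2) ℂ)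
    (hq : q ∈ Matrix.specialUnitaryGroup (Fin 2) ℂ)
    (hp' : p' ∈ Matrix.specialUnitaryGroup (Fin 2) ℂ)
    (hq' : q' ∈ Matrix.specialUnitaryGroup (Fin 2) ℂ) :
    sigmaMat (p * p') (q * q') = sigmaMat p q * sigmaMat p' q' := by
  obtain ⟨c, hc, -⟩ := exists_quatMat_of_mem (mul_mem hp hp')
  obtain ⟨d, hd, -⟩ := exists_quatMat_of_mem (mul_mem hq hq')
  obtain ⟨a, rfl, -⟩ := exists_quatMat_of_mem hp
  obtain ⟨b, rfl, -⟩ := exists_quatMat_of_mem hq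
  obtain ⟨a', rfl, -⟩ := exists_quatMat_of_mem hp'
  obtain ⟨b', rfl, -⟩ := exists_quatMat_of_mem hq'
  have key : ∀ v, (sigmaMat (quatMat a * quatMat a') (quatMat b * quatMat b')).mulVec v =
      (sigmaMat (quatMat a) (quatMat b) * sigmaMat (quatMat a') (quatMat b')).mulVec v := by
    intro v
    rw [← quatCoord_quatMat (Matrix.mulVec (_ * _) v), ← Matrix.mulVec_mulVec,
      quatMat_sigmaMat, quatMat_sigmaMat, ← quatCoord_quatMat (Matrix.mulVec _ v), hc, hd,
      quatMat_sigmaMat, ← hc, ← hd, star_mul]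
    simp only [mul_assoc]
  exact Matrix.mulVec_injective (funext key)

theorem sigmaMat_one : sigmaMat 1 1 = 1 := by
  ext i j
  fin_cases i <;> fin_cases j <;> simp [sigmaMat, quatUnit, quatCoord]

theorem sigmaMat_mem {p q : Matrix (Fin 2) (Fin 2) ℂ}
    (hp : p ∈ Matrix.specialUnitaryGroup (Fin 2) ℂ)
    (hq : q ∈ Matrix.specialUnitaryGroup (Fin 2) ℂ) :
    sigmaMat p q ∈ Matrix.specialOrthogonalGroup (Fin 4) ℝ := by
  obtain ⟨a, rfl, ha⟩ := exists_quatMat_of_mem hp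
  obtain ⟨b, rfl, hb⟩ := exists_quatMat_of_mem hq
  rw [Matrix.mem_specialOrthogonalGroup_iff, Matrix.mem_orthogonalGroup_iff, sigmaMat_quatMat]
  set L : Matrix (Fin 4) (Fin 4) ℝ :=
    !![a 0, -a 1, -a 2, -a 3; a 1, a 0, -a 3, a 2; a 2, a 3, a 0, -a 1; a 3, -a 2, a 1, a 0]
    with hL
  set R : Matrix (Fin 4) (Fin 4) ℝ :=
    !![b 0, b 1, b 2, b 3; -b 1, b 0, -b 3, b 2; -b 2, b 3, b 0, -b 1; -b 3, -b 2, b 1, b 0]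
    with hR
  have h1 : L * L.transpose = 1 := by
    ext i j
    fin_cases i <;> fin_cases j <;>
      simp [hL, Matrix.mul_apply, Fin.sum_univ_four] <;> first | ring1 | linear_combination ha
  have h2 : R * R.transpose = 1 := by
    ext i j
    fin_cases i <;> fin_cases j <;>
      simp [hR, Matrix.mul_apply, Fin.sum_univ_four] <;> first | ring1 | linear_combination hb
  have h3 : L.det = 1 := by
    have : L.det = (a 0 ^ 2 + a 1 ^ 2 + a 2 ^ 2 + a 3 ^ 2) ^ 2 := by
      rw [hL, Matrix.det_succ_row_zero]
      simp [Fin.sum_univ_four, Matrix.det_fin_three, Fin.succAbove]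
      ring
    rw [this, ha, one_pow]
  have h4 : R.det = 1 := by
    have : R.det = (b 0 ^ 2 + b 1 ^ 2 + b 2 ^ 2 + b 3 ^ 2) ^ 2 := by
      rw [hR, Matrix.det_succ_row_zero]
      simp [Fin.sum_univ_four, Matrix.det_fin_three, Fin.succAbove]
      ring
    rw [this, hb, one_pow]
  refine ⟨?_, ?_⟩
  · rw [Matrix.transpose_mul, mul_assoc, ← mul_assoc R, h2, one_mul, h1]
  · rw [Matrix.det_mul, h3, h4, one_mul]

theorem rhoMat_quatMat (a : Fin 4 → ℝ) :
    rhoMat (quatMat a) =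
      !![a 0 ^ 2 + a 1 ^ 2 - a 2 ^ 2 - a 3 ^ 2, 2 * (a 1 * a 2 - a 0 * a 3),
          2 * (a 1 * a 3 + a 0 * a 2);
        2 * (a 1 * a 2 + a 0 * a 3), a 0 ^ 2 - a 1 ^ 2 + a 2 ^ 2 - a 3 ^ 2,
          2 * (a 2 * a 3 - a 0 * a 1);
        2 * (a 1 * a 3 - a 0 * a 2), 2 * (a 2 * a 3 + a 0 * a 1),
          a 0 ^ 2 - a 1 ^ 2 - a 2 ^ 2 + a 3 ^ 2] := by
  simp only [rhoMat, quatMat_eq, quatUnit, quatCoord]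
  ext i j
  fin_cases i <;> fin_cases j <;>
    simp [Matrix.mul_apply, Fin.sum_univ_two, Matrix.star_apply] <;> ring

theorem rhoMat_mul {p p' : Matrix (Fin 2) (Fin 2) ℂ}
    (hp : p ∈ Matrix.specialUnitaryGroup (Fin 2) ℂ)
    (hp' : p' ∈ Matrix.specialUnitaryGroup (Fin 2) ℂ) :
    rhoMat (p * p') = rhoMat p * rhoMat p' := by
  have h := sigmaMat_mul hp hp hp' hp'
  have h0 : ∀ i : Fin 3, sigmaMat p p i.succ 0 = 0 := by
    obtain ⟨a, rfl, -⟩ := exists_quatMat_of_mem hp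
    intro i
    rw [sigmaMat_quatMat]
    fin_cases i <;> simp [Matrix.mul_apply, Fin.sum_univ_four] <;> ring
  ext i j
  have := congrFun (congrFun h i.succ) j.succ
  rw [Matrix.mul_apply, Fin.sum_univ_succ, h0, zero_mul, zero_add] at this
  exact this

theorem rhoMat_one : rhoMat 1 = 1 := by
  ext i j
  fin_cases i <;> fin_cases j <;> simp [rhoMat, quatUnit, quatCoord]

theorem rhoMat_mem {p : Matrix (Fin 2) (Fin 2) ℂ}
    (hp : p ∈ Matrix.specialUnitaryGroup (Fin 2) ℂ) :
    rhoMat p ∈ Matrix.specialOrthogonalGroup (Fin 3) ℝ := by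
  obtain ⟨a, rfl, ha⟩ := exists_quatMat_of_mem hp
  have h4 : (a 0 ^ 2 + a 1 ^ 2 + a 2 ^ 2 + a 3 ^ 2) ^ 2 = 1 := by rw [ha, one_pow]
  rw [Matrix.mem_specialOrthogonalGroup_iff, Matrix.mem_orthogonalGroup_iff, rhoMat_quatMat]
  refine ⟨?_, ?_⟩
  · ext i j
    fin_cases i <;> fin_cases j <;>
      simp [Matrix.mul_apply, Fin.sum_univ_three] <;> first | ring1 | linear_combination h4
  · have h6 : (a 0 ^ 2 + a 1 ^ 2 + a 2 ^ 2 + a 3 ^ 2) ^ 3 = 1 := by rw [ha, one_pow]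
    rw [Matrix.det_fin_three]
    simp
    linear_combination h6

/-- The double covering `ρ : SU(2) → SO(3)`. -/
def rho : SU2 →* SO3 where
  toFun p := ⟨rhoMat p, rhoMat_mem p.2⟩
  map_one' := Subtype.ext rhoMat_one
  map_mul' p p' := Subtype.ext (rhoMat_mul p.2 p'.2)

/-- The double covering `σ : SU(2) × SU(2) → SO(4)`. -/
def sigma : SU2 × SU2 →* SO4 where
  toFun p := ⟨sigmaMat p.1 p.2, sigmaMat_mem p.1.2 p.2.2⟩
  map_one' := Subtype.ext sigmaMat_one
  map_mul' p p' := Subtype.ext (sigmaMat_mul p.1.2 p.2.2 p'.1.2 p'.2.2)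

/-! ### The polyhedral groups and the bi-polyhedral groups -/

/-- The golden ratio `τ = (1 + √5) / 2`. -/
def tau : ℝ := (1 + √5) / 2

/-- The half-turn about the first axis. -/
def rotA1 : SO3 :=
  ⟨!![1, 0, 0; 0, -1, 0; 0, 0, -1], by
    rw [Matrix.mem_specialOrthogonalGroup_iff, Matrix.mem_orthogonalGroup_iff]
    constructor
    · ext i j
      fin_cases i <;> fin_cases j <;> simp [Matrix.mul_apply, Fin.sum_univ_three]
    · simp [Matrix.det_fin_three]⟩

/-- The half-turn about the second axis. -/
def rotA2 : SO3 :=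
  ⟨!![-1, 0, 0; 0, 1, 0; 0, 0, -1], by
    rw [Matrix.mem_specialOrthogonalGroup_iff, Matrix.mem_orthogonalGroup_iff]
    constructor
    · ext i j
      fin_cases i <;> fin_cases j <;> simp [Matrix.mul_apply, Fin.sum_univ_three]
    · simp [Matrix.det_fin_three]⟩

/-- A rotation of order three. -/
def rotR3 : SO3 :=
  ⟨!![0, -1, 0; 0, 0, -1; 1, 0, 0], by
    rw [Matrix.mem_specialOrthogonalGroup_iff, Matrix.mem_orthogonalGroup_iff]
    constructor
    · ext i j
      fin_cases i <;> fin_cases j <;> simp [Matrix.mul_apply, Fin.sum_univ_three]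
    · simp [Matrix.det_fin_three]⟩

/-- A rotation of order four. -/
def rotR4 : SO3 :=
  ⟨!![1, 0, 0; 0, 0, -1; 0, 1, 0], by
    rw [Matrix.mem_specialOrthogonalGroup_iff, Matrix.mem_orthogonalGroup_iff]
    constructor
    · ext i j
      fin_cases i <;> fin_cases j <;> simp [Matrix.mul_apply, Fin.sum_univ_three]
    · simp [Matrix.det_fin_three]⟩

theorem tau_sq : tau ^ 2 = tau + 1 := by
  have h : √5 ^ 2 = 5 := Real.sq_sqrt (by norm_num)
  unfold tau
  linear_combination h / 4

/-- A rotation of order five. -/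
def rotR5 : SO3 :=
  ⟨(1 / 2 : ℝ) • !![tau - 1, -tau, 1; tau, 1, tau - 1; -1, tau - 1, tau], by
    have h := tau_sq
    rw [Matrix.mem_specialOrthogonalGroup_iff, Matrix.mem_orthogonalGroup_iff]
    constructor
    · ext i j
      fin_cases i <;> fin_cases j <;> simp [Matrix.mul_apply, Fin.sum_univ_three] <;>
        first | ring1 | linear_combination h / 2 | linear_combination h / 4 |
          linear_combination -h / 4
    · simp [Matrix.det_fin_three]
      linear_combination (3 / 4) * h⟩

/-- The Klein four group. -/
def klein : Subgroup SO3 := Subgroup.closure {rotA1, rotA2}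

/-- The rotation group `T ≅ A₄` of the tetrahedron with vertices
`(1,1,1), (1,-1,-1), (-1,1,-1), (-1,-1,1)`. -/
def tetrahedral : Subgroup SO3 := Subgroup.closure {rotA1, rotA2, rotR3}

/-- The rotation group `O ≅ S₄` of the octahedron with vertices `± eᵢ`. -/
def octahedral : Subgroup SO3 := Subgroup.closure {rotA2, rotR3, rotR4}

/-- The rotation group `I ≅ A₅` of the icosahedron whose vertices are the cyclic permutations of
`(0, ±1, ±τ)`. -/
def icosahedral : Subgroup SO3 := Subgroup.closure {rotA1, rotA2, rotR5}

/-- For `G ⊆ SO(3)` the subgroup `σ(ρ⁻¹(G) × ρ⁻¹(G))` of `SO(4)`. -/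
def biGroup (G : Subgroup SO3) : Subgroup SO4 :=
  ((G.comap rho).prod (G.comap rho)).map sigma

/-- The group `H = σ(Ṽ × Ṽ)`. -/
def groupH : Subgroup SO4 := biGroup klein

/-- The bi-polyhedral group `G₆`. -/
def group6 : Subgroup SO4 := biGroup tetrahedral

/-- The bi-polyhedral group `G₈`. -/
def group8 : Subgroup SO4 := biGroup octahedral

/-- The bi-polyhedral group `G₁₂`. -/
def group12 : Subgroup SO4 := biGroup icosahedral

/-! ### Invariant polynomials, Poincaré series and Molien series -/

/-- For a real `4 × 4` matrix `A` and `f ∈ ℂ[x₀, x₁, x₂, x₃]`, the polynomial `f(A x)`. -/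
def polyComp (A : Matrix (Fin 4) (Fin 4) ℝ) :
    MvPolynomial (Fin 4) ℂ →ₐ[ℂ] MvPolynomial (Fin 4) ℂ :=
  MvPolynomial.aeval fun i => ∑ j, MvPolynomial.C (A i j : ℂ) * MvPolynomial.X j

/-- The space `ℂ[x₀, x₁, x₂, x₃]ᴳ_j` of `G`-invariant homogeneous polynomials of degree `j`
(with `0`); the action is `(g • f)(x) = f(g⁻¹ x)`. -/
def invariants (G : Subgroup SO4) (j : ℕ) : Submodule ℂ (MvPolynomial (Fin 4) ℂ) where
  carrier := {f | f.IsHomogeneous j ∧ ∀ g ∈ G, polyComp (g⁻¹ : SO4) f = f}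
  add_mem' hf hg := ⟨hf.1.add hg.1, fun g h => by rw [map_add, hf.2 g h, hg.2 g h]⟩
  zero_mem' := ⟨MvPolynomial.isHomogeneous_zero _ _ _, fun _ _ => map_zero _⟩
  smul_mem' c _ hf := ⟨(MvPolynomial.homogeneousSubmodule (Fin 4) ℂ j).smul_mem c hf.1,
    fun g h => by rw [map_smul, hf.2 g h]⟩

/-- The Poincaré series `∑ⱼ dim (ℂ[x₀, x₁, x₂, x₃]ᴳ_j) tʲ`, with coefficients read in `ℂ`. -/
def poincareSeries (G : Subgroup SO4) : PowerSeries ℂ :=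
  PowerSeries.mk fun j => (Module.finrank ℂ (invariants G j) : ℂ)

/-- The Molien series `(1 / |G|) ∑_{g ∈ G} 1 / det (id - g⁻¹ t)` of a finite group `G`,
as a formal power series in `t`. -/
def molienSeries (G : Subgroup SO4) : PowerSeries ℂ :=
  PowerSeries.C ((Nat.card G : ℂ)⁻¹) *
    ∑ᶠ g : G, (Matrix.det ((1 : Matrix (Fin 4) (Fin 4) (PowerSeries ℂ)) -
      Matrix.of fun i j =>
        PowerSeries.C ((((g : SO4)⁻¹ : SO4) : Matrix (Fin 4) (Fin 4) ℝ) i j : ℂ) *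
          PowerSeries.X))⁻¹

/-- The quadratic form `Q = x₀² + x₁² + x₂² + x₃²`. -/
def quadQ : MvPolynomial (Fin 4) ℂ := ∑ i, MvPolynomial.X i ^ 2

end Bipolyhedral

end

open Bipolyhedral

/-!
The proof rests on the decomposition of the polynomials of degree `j` on `ℝ⁴` into `Q ^ k` times
harmonic polynomials of degree `j - 2 k`, which as a representation of `SU(2) × SU(2)` are
`V ⊗ V` with `V` the symmetric power of `ℂ²` of degree `j - 2 k`. It is only needed for characters.

Molien's theorem (`poincareSeries_eq_molienSeries`) holds for every finite subgroup of `SO(4)`: the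
dimension of the invariants is the average of the traces on the homogeneous polynomials, and an
element of finite order is diagonalizable, so that on the monomials in eigenvectors its traces are
seen to have the generating series `1 / det (id - A t)` (`trace_symPower`).

For `σ(p, q)` the determinant only involves the real parts `x`, `y` of the unit quaternions `p` and
`q`, and `(1 - t²) / det (id - σ(p, q) t) = ∑ Uₙ(x) Uₙ(y) tⁿ` with the Chebyshev polynomials `Uₙ`
(`oneSubT_sigma_det`). Averaging over `ρ⁻¹(K) × ρ⁻¹(K)` shows that `1 - t²` times the Molien series
of `biGroup K` is `∑ Nₙ² tⁿ`, where `Nₙ` is the average of `Uₙ` over `ρ⁻¹(K)`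
(`molienSeries_biGroup_mul`). Since `-1 ∈ ρ⁻¹(K)`, `Nₙ` vanishes for odd `n`, and there are no
invariants of odd degree; for `n = 2 l` it is the average over `K` of a polynomial in the trace, the
character of the irreducible representation of `SO(3)` of dimension `2 l + 1`
(`chebAverage_two_mul`).

The polyhedral groups are enumerated along the chain `1 < klein < tetrahedral < octahedral` or
`icosahedral` by left cosets of the preceding group, which the generators permute (`Lists.closure`).
This yields the distribution of the traces, hence the numbers `Nₙ` and all dimensions up to
degree `15`.

In degree below `n` these dimensions leave room for the powers of `Q` only, and in degree `n` for
one more invariant `S`. Algebraic independence of `Q` and `S` is automatic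
(`algebraicIndependent_pair_of_isHomogeneous`): a relation makes `S / Q ^ (n / 2)` algebraic over
`ℂ`, hence constant.
-/

noncomputable section

namespace Bipolyhedral

/-! ### Traces on the symmetric powers -/

section SymmetricPowers

open MvPolynomial

variable {ι : Type*} [Fintype ι]

/-- The linear substitution `f ↦ f(A x)` for a complex square matrix `A`. -/
def linSubst (A : Matrix ι ι ℂ) : MvPolynomial ι ℂ →ₐ[ℂ] MvPolynomial ι ℂ :=
  aeval fun i => ∑ j, C (A i j) * X j

theorem linSubst_X (A : Matrix ι ι ℂ) (i : ι) : linSubst A (X i) = ∑ j, C (A i j) * X j := by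
  simp [linSubst]

/-- Substitution reverses products, which the inverse in `(g • f)(x) = f(g⁻¹ x)` undoes. -/
theorem linSubst_mul (A B : Matrix ι ι ℂ) (f : MvPolynomial ι ℂ) :
    linSubst (A * B) f = linSubst B (linSubst A f) := by
  suffices h : linSubst (A * B) = (linSubst B).comp (linSubst A) from DFunLike.congr_fun h f
  ext1 i
  simp only [AlgHom.comp_apply, linSubst_X, map_sum, map_mul, Matrix.mul_apply, Finset.mul_sum,
    Finset.sum_mul, MvPolynomial.algHom_C, MvPolynomial.algebraMap_eq]
  rw [Finset.sum_comm]
  simp only [mul_assoc]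

theorem linSubst_one [DecidableEq ι] (f : MvPolynomial ι ℂ) : linSubst 1 f = f := by
  suffices h : linSubst (1 : Matrix ι ι ℂ) = AlgHom.id ℂ _ from DFunLike.congr_fun h f
  ext1 i
  rw [linSubst_X, Finset.sum_eq_single i (by simp +contextual [eq_comm]) (by simp)]
  simp

theorem isHomogeneous_linSubst (A : Matrix ι ι ℂ) {f : MvPolynomial ι ℂ} {n : ℕ}
    (hf : f.IsHomogeneous n) : (linSubst A f).IsHomogeneous n := by
  have h := hf.aeval (n := 1) (fun i => ∑ j, C (A i j) * X j) fun i =>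
    IsHomogeneous.sum _ _ _ fun j _ => by
      simpa using (isHomogeneous_C ι (A i j)).mul (isHomogeneous_X ℂ j)
  rwa [one_mul] at h

/-- The substitution `f ↦ f(A x)` on the homogeneous polynomials of degree `n`. -/
def symPower (n : ℕ) (A : Matrix ι ι ℂ) : Module.End ℂ (homogeneousSubmodule ι ℂ n) :=
  (linSubst A).toLinearMap.restrict fun _ hf => isHomogeneous_linSubst A hf

theorem coe_symPower (n : ℕ) (A : Matrix ι ι ℂ) (f : homogeneousSubmodule ι ℂ n) :
    (symPower n A f : MvPolynomial ι ℂ) = linSubst A f := rfl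

theorem symPower_mul (n : ℕ) (A B : Matrix ι ι ℂ) :
    symPower n (A * B) = symPower n B * symPower n A :=
  LinearMap.ext fun f => Subtype.ext (linSubst_mul A B f)

theorem symPower_one [DecidableEq ι] (n : ℕ) : symPower n (1 : Matrix ι ι ℂ) = 1 :=
  LinearMap.ext fun f => Subtype.ext (linSubst_one (f : MvPolynomial ι ℂ))

variable [DecidableEq ι]

theorem degree_eq_of_mem_finsuppAntidiag {n : ℕ} {d : ι →₀ ℕ}
    (hd : d ∈ Finset.finsuppAntidiag Finset.univ n) : d.degree = n := by
  rw [Finset.mem_finsuppAntidiag] at hd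
  rw [Finsupp.degree_eq_sum]
  exact hd.1

variable (ι) in
/-- The basis of the homogeneous polynomials of degree `n` consisting of the monomials. -/
def monomialBasis (n : ℕ) :
    Module.Basis (Finset.finsuppAntidiag (Finset.univ : Finset ι) n) ℂ
      (homogeneousSubmodule ι ℂ n) :=
  Module.Basis.mk
    (v := fun d => ⟨monomial d.1 1,
      isHomogeneous_monomial 1 (degree_eq_of_mem_finsuppAntidiag d.2)⟩)
    (LinearIndependent.of_comp (homogeneousSubmodule ι ℂ n).subtype
      ((basisMonomials ι ℂ).linearIndependent.comp _ Subtype.val_injective))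
    (by
      rintro ⟨f, hf⟩ -
      have : (⟨f, hf⟩ : homogeneousSubmodule ι ℂ n) = ∑ d ∈ f.support.attach,
          coeff d.1 f • ⟨monomial d.1 1, isHomogeneous_monomial 1 (by
            by_contra hne
            exact mem_support_iff.1 d.2 (hf.coeff_eq_zero hne))⟩ := by
        apply Subtype.ext
        simp only [AddSubmonoidClass.coe_finsetSum, SetLike.val_smul, smul_monomial, smul_eq_mul,
          mul_one]
        rw [Finset.sum_attach f.support fun d => monomial d (coeff d f)]
        exact f.as_sum
      rw [this]
      refine Submodule.sum_mem _ fun d _ => Submodule.smul_mem _ _ (Submodule.subset_span ?_)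
      refine ⟨⟨d.1, ?_⟩, rfl⟩
      rw [Finset.mem_finsuppAntidiag]
      refine ⟨?_, Finset.subset_univ _⟩
      by_contra hne
      exact mem_support_iff.1 d.2 (hf.coeff_eq_zero (by rwa [Finsupp.degree_eq_sum])))

theorem coe_monomialBasis (n : ℕ) (d : Finset.finsuppAntidiag (Finset.univ : Finset ι) n) :
    (monomialBasis ι n d : MvPolynomial ι ℂ) = monomial d.1 1 := by
  simp [monomialBasis]

/-- The matrix `id - A t` over the power series in `t`. -/
def oneSubT (A : Matrix ι ι ℂ) : Matrix ι ι (PowerSeries ℂ) :=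
  1 - Matrix.of fun i j => PowerSeries.C (A i j) * PowerSeries.X

theorem inv_one_sub_C_mul_X (c : ℂ) :
    (1 - PowerSeries.C c * PowerSeries.X : PowerSeries ℂ)⁻¹ = PowerSeries.mk fun n => c ^ n := by
  symm
  rw [PowerSeries.eq_inv_iff_mul_eq_one (by simp)]
  ext n
  rcases n with _ | n
  · simp
  · rw [mul_sub, mul_one, mul_left_comm, map_sub, PowerSeries.coeff_C_mul,
      PowerSeries.coeff_succ_mul_X]
    simp [pow_succ', PowerSeries.coeff_one]

theorem linSubst_diagonal_monomial (c : ι → ℂ) (d : ι →₀ ℕ) :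
    linSubst (Matrix.diagonal c) (monomial d 1) = (∏ i, c i ^ d i) • monomial d 1 := by
  have hX (i : ι) : linSubst (Matrix.diagonal c) (X i) = C (c i) * X i := by
    rw [linSubst_X, Finset.sum_eq_single i
      (by simp +contextual [eq_comm]) (by simp)]
    simp
  rw [monomial_eq, Finsupp.prod_fintype _ _ (by simp)]
  simp [hX, mul_pow, Finset.prod_mul_distrib, smul_eq_C_mul]

theorem trace_symPower_diagonal (n : ℕ) (c : ι → ℂ) :
    LinearMap.trace ℂ _ (symPower n (Matrix.diagonal c)) =
      PowerSeries.coeff n (oneSubT (Matrix.diagonal c)).det⁻¹ := by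
  have h1 : oneSubT (Matrix.diagonal c) =
      Matrix.diagonal fun i => 1 - PowerSeries.C (c i) * PowerSeries.X := by
    ext1 i j
    by_cases h : i = j
    · subst h
      simp [oneSubT]
    · simp [oneSubT, h]
  have h2 : (∏ i, (1 - PowerSeries.C (c i) * PowerSeries.X : PowerSeries ℂ))⁻¹ =
      ∏ i, PowerSeries.mk fun n => c i ^ n := by
    symm
    rw [PowerSeries.eq_inv_iff_mul_eq_one (by simp [map_prod]), ← Finset.prod_mul_distrib]
    refine Finset.prod_eq_one fun i _ => ?_
    rw [← inv_one_sub_C_mul_X, PowerSeries.inv_mul_cancel _ (by simp)]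
  rw [h1, Matrix.det_diagonal, h2, PowerSeries.coeff_prod,
    LinearMap.trace_eq_matrix_trace ℂ (monomialBasis ι n), Matrix.trace]
  refine Eq.trans ?_ (Finset.sum_coe_sort _ _)
  refine Finset.sum_congr rfl fun d _ => ?_
  have h3 : symPower n (Matrix.diagonal c) (monomialBasis ι n d) =
      (∏ i, c i ^ d.1 i) • monomialBasis ι n d := by
    apply Subtype.ext
    rw [coe_symPower, SetLike.val_smul, coe_monomialBasis, linSubst_diagonal_monomial]
  rw [Matrix.diag_apply, LinearMap.toMatrix_apply, h3]
  simp

/-- A complex matrix of finite order is diagonalizable, because `X ^ k - 1` is separable. -/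
theorem exists_eq_mul_diagonal_mul {A : Matrix ι ι ℂ} {k : ℕ} (hk : k ≠ 0) (hA : A ^ k = 1) :
    ∃ (P P' : Matrix ι ι ℂ) (c : ι → ℂ), P * P' = 1 ∧ A = P * Matrix.diagonal c * P' := by
  set f : Module.End ℂ (ι → ℂ) := Matrix.toLin' A with hf
  have hss : f.IsSemisimple := by
    refine Module.End.isSemisimple_of_squarefree_aeval_eq_zero
      (p := Polynomial.X ^ k - 1) (Polynomial.separable_X_pow_sub_C 1 (by exact_mod_cast hk)
        one_ne_zero).squarefree ?_
    simp [hf, ← Matrix.toLin'_pow, hA, Module.End.one_eq_id]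
  let D := DirectSum.isInternal_submodule_of_iSupIndep_of_iSup_eq_top
    f.eigenspaces_iSupIndep hss.iSup_eigenspace_eq_top
  let v := D.collectedBasis fun μ => Module.finBasis ℂ (f.eigenspace μ)
  let e := v.indexEquiv (Pi.basisFun ℂ ι)
  let w := v.reindex e
  have hw (i : ι) : f (w i) = (e.symm i).1 • w i := by
    simp only [w, Module.Basis.reindex_apply]
    exact Module.End.mem_eigenspace_iff.1 (D.collectedBasis_mem _ _)
  refine ⟨(Pi.basisFun ℂ ι).toMatrix w, w.toMatrix (Pi.basisFun ℂ ι), fun i => (e.symm i).1,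
    Module.Basis.toMatrix_mul_toMatrix_flip _ _, ?_⟩
  have h1 : LinearMap.toMatrix w w f = Matrix.diagonal fun i => (e.symm i).1 := by
    ext i j
    rw [LinearMap.toMatrix_apply, hw, Matrix.diagonal_apply]
    by_cases h : i = j
    · subst h
      simp
    · simp [h]
  rw [← h1, basis_toMatrix_mul_linearMap_toMatrix_mul_basis_toMatrix, hf,
    LinearMap.toMatrix_eq_toMatrix', LinearMap.toMatrix'_toLin']

/-- The trace on the symmetric powers of a matrix of finite order has the generating series
`1 / det (id - A t)`. -/
theorem trace_symPower (n : ℕ) {A : Matrix ι ι ℂ} {k : ℕ} (hk : k ≠ 0) (hA : A ^ k = 1) :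
    LinearMap.trace ℂ _ (symPower n A) = PowerSeries.coeff n (oneSubT A).det⁻¹ := by
  obtain ⟨P, P', c, hP, rfl⟩ := exists_eq_mul_diagonal_mul hk hA
  have hP' : P' * P = 1 := mul_eq_one_comm.1 hP
  have h1 : oneSubT (P * Matrix.diagonal c * P') = P.map PowerSeries.C *
      oneSubT (Matrix.diagonal c) * P'.map PowerSeries.C := by
    have h2 (A : Matrix ι ι ℂ) : oneSubT A =
        1 - (PowerSeries.X : PowerSeries ℂ) • A.map PowerSeries.C := by
      ext1 i j
      simp [oneSubT, mul_comm]
    have h3 : P.map (PowerSeries.C (R := ℂ)) * P'.map (PowerSeries.C (R := ℂ)) = 1 := by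
      rw [← Matrix.map_mul, hP]
      simp
    rw [h2, h2, mul_sub, sub_mul, mul_one, h3, Matrix.map_mul, Matrix.map_mul]
    simp
  rw [h1, Matrix.det_mul, Matrix.det_mul, mul_right_comm, ← Matrix.det_mul, ← Matrix.map_mul, hP,
    symPower_mul, symPower_mul, LinearMap.trace_mul_comm, mul_assoc, ← symPower_mul, hP',
    symPower_one, mul_one, trace_symPower_diagonal]
  simp

end SymmetricPowers

/-! ### Averages over finite groups and Molien's theorem -/

section Molien

open MvPolynomial

/-- The complex matrix of an element of `SO(4)`. -/
def complexMatrix (g : SO4) : Matrix (Fin 4) (Fin 4) ℂ :=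
  (g : Matrix (Fin 4) (Fin 4) ℝ).map (algebraMap ℝ ℂ)

theorem complexMatrix_mul (g h : SO4) :
    complexMatrix (g * h) = complexMatrix g * complexMatrix h :=
  Matrix.map_mul

theorem complexMatrix_one : complexMatrix 1 = 1 :=
  Matrix.map_one _ (map_zero _) (map_one _)

theorem complexMatrix_pow (g : SO4) (k : ℕ) : complexMatrix (g ^ k) = complexMatrix g ^ k := by
  induction k with
  | zero => exact complexMatrix_one
  | succ k ih => rw [pow_succ, pow_succ, complexMatrix_mul, ih]

/-- The representation `(g • f)(x) = f(g⁻¹ x)` of `G` on the homogeneous polynomials. -/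
def polyRep (G : Subgroup SO4) (n : ℕ) :
    Representation ℂ G (homogeneousSubmodule (Fin 4) ℂ n) where
  toFun g := symPower n (complexMatrix (g : SO4)⁻¹)
  map_one' := by rw [Subgroup.coe_one, inv_one, complexMatrix_one, symPower_one]
  map_mul' g h := by rw [Subgroup.coe_mul, mul_inv_rev, complexMatrix_mul, symPower_mul]

theorem invariants_eq_map (G : Subgroup SO4) (n : ℕ) :
    invariants G n =
      (polyRep G n).invariants.map (homogeneousSubmodule (Fin 4) ℂ n).subtype := by
  ext f
  rw [Submodule.mem_map]
  constructor
  · rintro ⟨hf, hG⟩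
    exact ⟨⟨f, hf⟩, fun g => Subtype.ext (hG g g.2), rfl⟩
  · rintro ⟨⟨f, hf⟩, hG, rfl⟩
    exact ⟨hf, fun g hg => congrArg Subtype.val (hG ⟨g, hg⟩)⟩

instance finite_homogeneousSubmodule (n : ℕ) :
    Module.Finite ℂ (homogeneousSubmodule (Fin 4) ℂ n) :=
  Module.Finite.of_basis (monomialBasis (Fin 4) n)

instance finite_invariants (G : Subgroup SO4) (n : ℕ) : Module.Finite ℂ (invariants G n) := by
  rw [invariants_eq_map]
  infer_instance

/-- The average of a complex valued function over a finite type (and `0` for an infinite one, where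
`Nat.card` is `0`). -/
def average {A : Type*} (f : A → ℂ) : ℂ := (Nat.card A : ℂ)⁻¹ * ∑ᶠ a, f a

theorem average_eq_sum {A : Type*} [Fintype A] (f : A → ℂ) :
    average f = (Nat.card A : ℂ)⁻¹ * ∑ a, f a := by
  rw [average, finsum_eq_sum_of_fintype]

theorem average_comp_equiv {A B : Type*} (e : A ≃ B) (f : B → ℂ) :
    average (fun a => f (e a)) = average f := by
  rw [average, average, Nat.card_congr e, finsum_comp_equiv e]

/-- All fibres of a surjective homomorphism have the same size, so averages may be pulled back. -/
theorem average_comp_hom {A B : Type*} [Group A] [Group B] [Finite A] (φ : A →* B)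
    (hφ : Function.Surjective φ) (f : B → ℂ) : average (fun a => f (φ a)) = average f := by
  classical
  have := Fintype.ofFinite A
  have : Finite B := Finite.of_surjective φ hφ
  have := Fintype.ofFinite B
  have hfib (b : B) : (Finset.univ.filter fun a => φ a = b).card = Nat.card φ.ker := by
    rw [MonoidHom.card_fiber_eq_of_mem_range φ (hφ b) (hφ 1), Nat.card_eq_fintype_card,
      Fintype.card_subtype]
    simp [MonoidHom.mem_ker]
  have hsum : ∑ a, f (φ a) = Nat.card φ.ker * ∑ b, f b := by
    rw [← Finset.sum_fiberwise Finset.univ φ, Finset.mul_sum]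
    refine Finset.sum_congr rfl fun b _ => ?_
    rw [Finset.sum_congr rfl fun a ha => by rw [(Finset.mem_filter.1 ha).2], Finset.sum_const,
      hfib, nsmul_eq_mul]
  have hcard : Nat.card A = Nat.card φ.ker * Nat.card B := by
    have : (∑ b : B, (Finset.univ.filter fun a => φ a = b).card) = Fintype.card A :=
      (Finset.card_eq_sum_card_fiberwise fun _ _ => Finset.mem_univ _).symm
    rw [Nat.card_eq_fintype_card, ← this]
    simp [hfib, mul_comm]
  have h0 : (Nat.card φ.ker : ℂ) ≠ 0 := Nat.cast_ne_zero.2 Nat.card_pos.ne'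
  rw [average_eq_sum, average_eq_sum, hsum, hcard, Nat.cast_mul]
  field_simp

theorem average_prod {A B : Type*} [Finite A] [Finite B] (f : A → ℂ) (g : B → ℂ) :
    average (fun x : A × B => f x.1 * g x.2) = average f * average g := by
  have := Fintype.ofFinite A
  have := Fintype.ofFinite B
  rw [average_eq_sum, average_eq_sum, average_eq_sum, Nat.card_prod, Fintype.sum_prod_type,
    Nat.cast_mul, mul_inv, mul_mul_mul_comm, Finset.sum_mul_sum]

theorem coeff_molienSeries (G : Subgroup SO4) [Finite G] (n : ℕ) :
    PowerSeries.coeff n (molienSeries G) =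
      average fun g : G => PowerSeries.coeff n (oneSubT (complexMatrix (g : SO4)⁻¹)).det⁻¹ := by
  have := Fintype.ofFinite G
  rw [molienSeries, average_eq_sum, finsum_eq_sum_of_fintype, PowerSeries.coeff_C_mul, map_sum]
  rfl

/-- Molien's theorem: the dimension of the invariants is the average of the traces. -/
theorem poincareSeries_eq_molienSeries (G : Subgroup SO4) [Finite G] :
    poincareSeries G = molienSeries G := by
  have := Fintype.ofFinite G
  have : Invertible (Nat.card G : ℂ) :=
    invertibleOfNonzero (Nat.cast_ne_zero.2 Nat.card_pos.ne')
  ext n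
  rw [poincareSeries, PowerSeries.coeff_mk, coeff_molienSeries, average_eq_sum, invariants_eq_map,
    ← (Submodule.equivSubtypeMap _ _).finrank_eq,
    ← Representation.card_inv_mul_sum_char_eq_finrank (polyRep G n)]
  congr 1
  refine Finset.sum_congr rfl fun g _ => trace_symPower n (k := orderOf g) (orderOf_pos g).ne' ?_
  rw [← complexMatrix_pow, inv_pow, ← Subgroup.coe_pow, pow_orderOf_eq_one, Subgroup.coe_one,
    inv_one, complexMatrix_one]

end Molien

/-! ### The Molien series of a bi-polyhedral group -/

/-- `id - t L(a) R(b)`, with `L(a)` and `R(b)` the matrices of `x ↦ a x` and `x ↦ x b̄`, has a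
determinant that depends on the real parts `a 0` and `b 0` of the unit quaternions only. -/
theorem det_one_sub_smul_leftMul_mul_rightMul {R : Type*} [CommRing R] (a b : Fin 4 → R) (t : R)
    (ha : a 0 ^ 2 + a 1 ^ 2 + a 2 ^ 2 + a 3 ^ 2 = 1)
    (hb : b 0 ^ 2 + b 1 ^ 2 + b 2 ^ 2 + b 3 ^ 2 = 1) :
    (1 - t • (!![a 0, -a 1, -a 2, -a 3; a 1, a 0, -a 3, a 2; a 2, a 3, a 0, -a 1;
        a 3, -a 2, a 1, a 0] *
      !![b 0, b 1, b 2, b 3; -b 1, b 0, -b 3, b 2; -b 2, b 3, b 0, -b 1;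
        -b 3, -b 2, b 1, b 0]) : Matrix (Fin 4) (Fin 4) R).det =
      1 - 4 * (a 0 * b 0) * t + (4 * a 0 ^ 2 + 4 * b 0 ^ 2 - 2) * t ^ 2 - 4 * (a 0 * b 0) * t ^ 3 +
        t ^ 4 := by
  set L : Matrix (Fin 4) (Fin 4) R := !![a 0, -a 1, -a 2, -a 3; a 1, a 0, -a 3, a 2;
    a 2, a 3, a 0, -a 1; a 3, -a 2, a 1, a 0] with hL
  set S : Matrix (Fin 4) (Fin 4) R := !![b 0, b 1, b 2, b 3; -b 1, b 0, -b 3, b 2;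
    -b 2, b 3, b 0, -b 1; -b 3, -b 2, b 1, b 0] with hS
  have hLL : L * L.transpose = 1 := by
    ext i j
    fin_cases i <;> fin_cases j <;>
      simp [hL, Matrix.mul_apply, Fin.sum_univ_four] <;> first | ring1 | linear_combination ha
  have hdet : L.det = 1 := by
    have : L.det = (a 0 ^ 2 + a 1 ^ 2 + a 2 ^ 2 + a 3 ^ 2) ^ 2 := by
      rw [hL, Matrix.det_succ_row_zero]
      simp [Fin.sum_univ_four, Matrix.det_fin_three, Fin.succAbove]
      ring
    rw [this, ha, one_pow]
  -- Factoring out `L` leaves a matrix with entries linear in `a` and `b`.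
  have hfac : 1 - t • (L * S) = L * (L.transpose - t • S) := by
    rw [mul_sub, hLL, Matrix.mul_smul]
  have hhom : (L.transpose - t • S).det =
      (a 0 ^ 2 + a 1 ^ 2 + a 2 ^ 2 + a 3 ^ 2) ^ 2 -
      4 * (a 0 * b 0) * t * (a 0 ^ 2 + a 1 ^ 2 + a 2 ^ 2 + a 3 ^ 2) +
      (4 * a 0 ^ 2 * (b 0 ^ 2 + b 1 ^ 2 + b 2 ^ 2 + b 3 ^ 2) +
        4 * b 0 ^ 2 * (a 0 ^ 2 + a 1 ^ 2 + a 2 ^ 2 + a 3 ^ 2) -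
        2 * (a 0 ^ 2 + a 1 ^ 2 + a 2 ^ 2 + a 3 ^ 2) * (b 0 ^ 2 + b 1 ^ 2 + b 2 ^ 2 + b 3 ^ 2)) *
        t ^ 2 -
      4 * (a 0 * b 0) * (b 0 ^ 2 + b 1 ^ 2 + b 2 ^ 2 + b 3 ^ 2) * t ^ 3 +
      (b 0 ^ 2 + b 1 ^ 2 + b 2 ^ 2 + b 3 ^ 2) ^ 2 * t ^ 4 := by
    rw [hL, hS, Matrix.det_succ_row_zero]
    simp [Fin.sum_univ_four, Matrix.det_fin_three, Fin.succAbove]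
    ring
  rw [hfac, Matrix.det_mul, hdet, hhom, ha, hb]
  ring

/-- The value at `x` of the Chebyshev polynomial of the second kind `Uₙ`: the character of the
`n`-th symmetric power of `ℂ²` at an element of `SU(2)` with real part `x`. -/
def chebU (n : ℕ) (x : ℝ) : ℝ := (Polynomial.Chebyshev.U ℝ n).eval x

theorem chebU_zero (x : ℝ) : chebU 0 x = 1 := by simp [chebU]

theorem chebU_one (x : ℝ) : chebU 1 x = 2 * x := by simp [chebU]

theorem chebU_add_two (n : ℕ) (x : ℝ) : chebU (n + 2) x = 2 * x * chebU (n + 1) x - chebU n x := by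
  simp [chebU, Polynomial.Chebyshev.U_add_two]

theorem chebU_neg (n : ℕ) (x : ℝ) : chebU n (-x) = (-1) ^ n * chebU n x := by
  rw [chebU, Polynomial.Chebyshev.U_eval_neg]
  simp [chebU, Int.negOnePow_def]

/-- The generating series of `Uₙ(x) Uₙ(y)`. This is the character form of the decomposition of the
polynomials into powers of `Q` times harmonic polynomials. -/
theorem mk_chebU_mul_chebU (x y : ℝ) :
    ((1 - 4 * (PowerSeries.C (x : ℂ) * PowerSeries.C (y : ℂ)) * PowerSeries.X +
      (4 * PowerSeries.C (x : ℂ) ^ 2 + 4 * PowerSeries.C (y : ℂ) ^ 2 - 2) * PowerSeries.X ^ 2 -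
      4 * (PowerSeries.C (x : ℂ) * PowerSeries.C (y : ℂ)) * PowerSeries.X ^ 3 +
      PowerSeries.X ^ 4) : PowerSeries ℂ) *
      PowerSeries.mk (fun n => (chebU n x * chebU n y : ℂ)) = 1 - PowerSeries.X ^ 2 := by
  have e : ((1 - 4 * (PowerSeries.C (x : ℂ) * PowerSeries.C (y : ℂ)) * PowerSeries.X +
      (4 * PowerSeries.C (x : ℂ) ^ 2 + 4 * PowerSeries.C (y : ℂ) ^ 2 - 2) * PowerSeries.X ^ 2 -
      4 * (PowerSeries.C (x : ℂ) * PowerSeries.C (y : ℂ)) * PowerSeries.X ^ 3 +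
      PowerSeries.X ^ 4) : PowerSeries ℂ) =
      1 - PowerSeries.C (4 * x * y : ℂ) * PowerSeries.X ^ 1 +
        PowerSeries.C (4 * x ^ 2 + 4 * y ^ 2 - 2 : ℂ) * PowerSeries.X ^ 2 -
        PowerSeries.C (4 * x * y : ℂ) * PowerSeries.X ^ 3 + PowerSeries.X ^ 4 := by
    simp only [map_add, map_sub, map_mul, map_pow, map_ofNat]
    ring
  have h2 (z : ℝ) : chebU 2 z = 4 * z ^ 2 - 1 := by
    rw [chebU_add_two 0, zero_add, chebU_one, chebU_zero]; ring
  have h3 (z : ℝ) : chebU 3 z = 8 * z ^ 3 - 4 * z := by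
    rw [chebU_add_two 1, chebU_one, h2]; ring
  rw [e]
  ext n
  simp only [add_mul, sub_mul, one_mul, mul_assoc, map_add, map_sub, PowerSeries.coeff_C_mul,
    PowerSeries.coeff_X_pow_mul', PowerSeries.coeff_mk]
  -- The first coefficients involve the initial values, the others the recurrence of `Uₙ`.
  rcases n with _ | _ | _ | _ | n
  · simp [chebU_zero, PowerSeries.coeff_X_pow]
  · simp [chebU_zero, chebU_one, PowerSeries.coeff_X_pow, PowerSeries.coeff_one]
    ring
  · simp [chebU_zero, chebU_one, h2, PowerSeries.coeff_X_pow, PowerSeries.coeff_one]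
    ring
  · simp [chebU_zero, chebU_one, h2, h3, PowerSeries.coeff_X_pow, PowerSeries.coeff_one]
    ring
  · simp [PowerSeries.coeff_X_pow, PowerSeries.coeff_one]
    rw [chebU_add_two (n + 1 + 1), chebU_add_two (n + 1), chebU_add_two n,
      chebU_add_two (n + 1 + 1), chebU_add_two (n + 1), chebU_add_two n]
    push_cast
    ring

/-- The real part of a quaternion. -/
def realPart (p : SU2) : ℝ := quatCoord p.1 0

theorem oneSubT_sigma_det (p q : SU2) :
    (oneSubT (complexMatrix (sigma (p, q)))).det⁻¹ * (1 - PowerSeries.X ^ 2) =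
      PowerSeries.mk fun n => (chebU n (realPart p) * chebU n (realPart q) : ℂ) := by
  obtain ⟨a, hpa, ha⟩ := exists_quatMat_of_mem p.2
  obtain ⟨b, hqb, hb⟩ := exists_quatMat_of_mem q.2
  have hp : realPart p = a 0 := by rw [realPart, hpa, quatCoord_quatMat]
  have hq : realPart q = b 0 := by rw [realPart, hqb, quatCoord_quatMat]
  let φ : ℝ →+* PowerSeries ℂ := (PowerSeries.C (R := ℂ)).comp (algebraMap ℝ ℂ)
  have hM : oneSubT (complexMatrix (sigma (p, q))) =
      1 - (PowerSeries.X : PowerSeries ℂ) • ((sigmaMat p.1 q.1).map φ) := by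
    ext1 i j
    simp only [oneSubT, Matrix.sub_apply, Matrix.of_apply, Matrix.smul_apply, smul_eq_mul]
    rw [mul_comm]
    rfl
  have hmap : (sigmaMat p.1 q.1).map φ =
      !![φ (a 0), -φ (a 1), -φ (a 2), -φ (a 3); φ (a 1), φ (a 0), -φ (a 3), φ (a 2);
        φ (a 2), φ (a 3), φ (a 0), -φ (a 1); φ (a 3), -φ (a 2), φ (a 1), φ (a 0)] *
      !![φ (b 0), φ (b 1), φ (b 2), φ (b 3); -φ (b 1), φ (b 0), -φ (b 3), φ (b 2);
        -φ (b 2), φ (b 3), φ (b 0), -φ (b 1); -φ (b 3), -φ (b 2), φ (b 1), φ (b 0)] := by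
    rw [hpa, hqb, sigmaMat_quatMat, Matrix.map_mul]
    congr 1 <;> ext1 i j <;> fin_cases i <;> fin_cases j <;> simp
  have hdet := det_one_sub_smul_leftMul_mul_rightMul (fun i => φ (a i)) (fun i => φ (b i))
    PowerSeries.X (by simp only [← map_pow, ← map_add, ha, map_one])
    (by simp only [← map_pow, ← map_add, hb, map_one])
  rw [hM, hmap, hp, hq, hdet, ← mk_chebU_mul_chebU, ← mul_assoc]
  change (_ : PowerSeries ℂ)⁻¹ * _ * _ = _
  rw [show φ (a 0) = PowerSeries.C ((a 0 : ℝ) : ℂ) from rfl,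
    show φ (b 0) = PowerSeries.C ((b 0 : ℝ) : ℂ) from rfl,
    PowerSeries.inv_mul_cancel _ (by simp), one_mul]

/-- The average of `Uₙ` over the double cover `ρ⁻¹(K)` of `K`: the dimension of the
`ρ⁻¹(K)`-invariants in the `n`-th symmetric power of `ℂ²`. -/
def chebAverage (K : Subgroup SO3) (n : ℕ) : ℂ :=
  average fun p : K.comap rho => (chebU n (realPart p) : ℂ)

/-- The homomorphism of `ρ⁻¹(K) × ρ⁻¹(K)` onto the bi-polyhedral group of `K`. -/
def coverHom (K : Subgroup SO3) : K.comap rho × K.comap rho →* biGroup K :=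
  (sigma.subgroupMap ((K.comap rho).prod (K.comap rho))).comp
    ((K.comap rho).prodEquiv (K.comap rho)).symm.toMonoidHom

theorem coverHom_surjective (K : Subgroup SO3) : Function.Surjective (coverHom K) :=
  (sigma.subgroupMap_surjective _).comp ((K.comap rho).prodEquiv (K.comap rho)).symm.surjective

theorem coe_coverHom (K : Subgroup SO3) (x : K.comap rho × K.comap rho) :
    (coverHom K x : SO4) = sigma (x.1, x.2) := rfl

theorem finite_biGroup (K : Subgroup SO3) [Finite (K.comap rho)] : Finite (biGroup K) :=
  Finite.of_surjective _ (coverHom_surjective K)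

theorem molienSeries_biGroup_mul (K : Subgroup SO3) [Finite (K.comap rho)] :
    molienSeries (biGroup K) * (1 - PowerSeries.X ^ 2) =
      PowerSeries.mk fun n => chebAverage K n ^ 2 := by
  have := finite_biGroup K
  have := Fintype.ofFinite (biGroup K)
  ext n
  have h1 : PowerSeries.coeff n (molienSeries (biGroup K) * (1 - PowerSeries.X ^ 2)) =
      average fun g : biGroup K => PowerSeries.coeff n
        ((oneSubT (complexMatrix ((g⁻¹ : biGroup K) : SO4))).det⁻¹ * (1 - PowerSeries.X ^ 2)) := by
    rw [molienSeries, average_eq_sum, finsum_eq_sum_of_fintype, mul_assoc,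
      PowerSeries.coeff_C_mul, Finset.sum_mul, map_sum]
    rfl
  rw [h1]
  refine (average_comp_equiv (Equiv.inv (biGroup K)) fun g => PowerSeries.coeff n
    ((oneSubT (complexMatrix (g : SO4))).det⁻¹ * (1 - PowerSeries.X ^ 2))).trans ?_
  rw [← average_comp_hom (coverHom K) (coverHom_surjective K), PowerSeries.coeff_mk,
    pow_two (chebAverage K n), chebAverage, ← average_prod]
  simp only [coe_coverHom, oneSubT_sigma_det, PowerSeries.coeff_mk]

theorem coeff_molienSeries_biGroup_add_two (K : Subgroup SO3) [Finite (K.comap rho)] (n : ℕ) :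
    PowerSeries.coeff (n + 2) (molienSeries (biGroup K)) =
      PowerSeries.coeff n (molienSeries (biGroup K)) + chebAverage K (n + 2) ^ 2 := by
  have h := congrArg (PowerSeries.coeff (n + 2)) (molienSeries_biGroup_mul K)
  rw [mul_sub, mul_one, map_sub, PowerSeries.coeff_mul_X_pow, PowerSeries.coeff_mk] at h
  linear_combination h

theorem coeff_molienSeries_biGroup_of_lt_two (K : Subgroup SO3) [Finite (K.comap rho)] {n : ℕ}
    (hn : n < 2) : PowerSeries.coeff n (molienSeries (biGroup K)) = chebAverage K n ^ 2 := by
  have h := congrArg (PowerSeries.coeff n) (molienSeries_biGroup_mul K)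
  rwa [mul_sub, mul_one, map_sub, PowerSeries.coeff_mul_X_pow', if_neg (by omega), sub_zero,
    PowerSeries.coeff_mk] at h

/-! ### The double cover of `SO(3)` -/

theorem quatMat_mem {a : Fin 4 → ℝ} (ha : a 0 ^ 2 + a 1 ^ 2 + a 2 ^ 2 + a 3 ^ 2 = 1) :
    quatMat a ∈ Matrix.specialUnitaryGroup (Fin 2) ℂ := by
  have hI := Complex.I_sq
  have ha' : (a 0 : ℂ) ^ 2 + (a 1 : ℂ) ^ 2 + (a 2 : ℂ) ^ 2 + (a 3 : ℂ) ^ 2 = 1 := by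
    exact_mod_cast ha
  rw [Matrix.mem_specialUnitaryGroup_iff, Matrix.mem_unitaryGroup_iff, quatMat_eq]
  constructor
  · ext i j
    fin_cases i <;> fin_cases j <;>
      simp [Matrix.mul_apply, Fin.sum_univ_two, Matrix.star_apply] <;>
      first | ring1 | linear_combination ha' - (a 1 ^ 2 + a 3 ^ 2 : ℂ) * hI
  · rw [Matrix.det_fin_two_of]
    linear_combination ha' - (a 1 ^ 2 + a 3 ^ 2 : ℂ) * hI

theorem trace_rho (p : SU2) :
    Matrix.trace (rho p : Matrix (Fin 3) (Fin 3) ℝ) = 4 * realPart p ^ 2 - 1 := by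
  obtain ⟨a, hpa, ha⟩ := exists_quatMat_of_mem p.2
  have hp : realPart p = a 0 := by rw [realPart, hpa, quatCoord_quatMat]
  change Matrix.trace (rhoMat p.1) = _
  rw [hpa, rhoMat_quatMat, hp, Matrix.trace_fin_three]
  simp
  linear_combination -ha

/-- The unit quaternion `-1`. -/
def negOne : SU2 := ⟨quatMat ![-1, 0, 0, 0], quatMat_mem (by simp)⟩

theorem rho_negOne : rho negOne = 1 := by
  apply Subtype.ext
  change rhoMat (quatMat _) = 1
  rw [rhoMat_quatMat]
  ext i j
  fin_cases i <;> fin_cases j <;> simp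

theorem realPart_negOne_mul (p : SU2) : realPart (negOne * p) = -realPart p := by
  obtain ⟨a, hpa, ha⟩ := exists_quatMat_of_mem p.2
  rw [realPart, realPart, hpa, quatCoord_quatMat, Submonoid.coe_mul, hpa, negOne]
  simp [quatMat_eq, quatCoord]

theorem eq_one_or_eq_negOne_of_rho_eq_one {p : SU2} (hp : rho p = 1) : p = 1 ∨ p = negOne := by
  obtain ⟨a, hpa, ha⟩ := exists_quatMat_of_mem p.2
  have hp : rhoMat p.1 = 1 := congrArg Subtype.val hp
  rw [hpa, rhoMat_quatMat] at hp
  have e0 := congrFun (congrFun hp 0) 0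
  have e1 := congrFun (congrFun hp 1) 1
  have e2 := congrFun (congrFun hp 2) 2
  simp at e0 e1 e2
  have a1 : a 1 = 0 := by nlinarith
  have a2 : a 2 = 0 := by nlinarith
  have a3 : a 3 = 0 := by nlinarith
  have a0 : a 0 = 1 ∨ a 0 = -1 := sq_eq_one_iff.1 (by simpa [a1, a2, a3] using ha)
  refine a0.imp (fun a0 => Subtype.ext ?_) fun a0 => Subtype.ext ?_
  · rw [hpa, quatMat_eq, a0, a1, a2, a3]
    ext i j
    fin_cases i <;> fin_cases j <;> simp
  · change p.1 = quatMat ![-1, 0, 0, 0]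
    rw [hpa, quatMat_eq, quatMat_eq, a0, a1, a2, a3]
    simp

theorem finite_comap_rho (K : Subgroup SO3) [Finite K] : Finite (K.comap rho) := by
  rw [(rho.subgroupComap K).finite_iff_finite_ker_range]
  refine ⟨?_, inferInstance⟩
  have hfin : ((↑) ⁻¹' {1, negOne} : Set (K.comap rho)).Finite :=
    (Set.toFinite {1, negOne}).preimage Subtype.val_injective.injOn
  exact hfin.subset fun p hp =>
    eq_one_or_eq_negOne_of_rho_eq_one (congrArg Subtype.val (MonoidHom.mem_ker.1 hp))

/-- The characters of `SO(3)` as functions of the trace: `rotChar l` is the character of the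
irreducible representation of dimension `2 l + 1`. -/
def rotChar : ℕ → ℝ → ℝ
  | 0, _ => 1
  | 1, x => x
  | l + 2, x => (x - 1) * rotChar (l + 1) x - rotChar l x

theorem chebU_two_mul (l : ℕ) (x : ℝ) : chebU (2 * l) x = rotChar l (4 * x ^ 2 - 1) := by
  induction l using Nat.strong_induction_on with
  | _ l ih =>
    rcases l with _ | _ | l
    · simp [chebU_zero, rotChar]
    · rw [show 2 * (0 + 1) = 0 + 2 from rfl, chebU_add_two 0, zero_add, chebU_one, chebU_zero,
        rotChar]
      ring
    · rw [rotChar, ← ih l (by omega), ← ih (l + 1) (by omega),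
        show 2 * (l + 1 + 1) = 2 * l + 2 + 2 by ring, show 2 * (l + 1) = 2 * l + 2 by ring,
        chebU_add_two (2 * l + 2), chebU_add_two (2 * l + 1), chebU_add_two (2 * l)]
      ring

/-- For odd `n` the function `Uₙ` is odd, and `ρ⁻¹(K)` is stable under multiplication by `-1`. -/
theorem chebAverage_of_odd (K : Subgroup SO3) {n : ℕ} (hn : Odd n) : chebAverage K n = 0 := by
  have hm : negOne ∈ K.comap rho := by
    rw [Subgroup.mem_comap, rho_negOne]
    exact K.one_mem
  have h := average_comp_equiv (Equiv.mulLeft (⟨negOne, hm⟩ : K.comap rho))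
    fun p => (chebU n (realPart p) : ℂ)
  rw [chebAverage]
  simp only [Equiv.coe_mulLeft, Subgroup.coe_mul, realPart_negOne_mul, chebU_neg, hn.neg_one_pow,
    neg_one_mul, Complex.ofReal_neg] at h
  rw [average, finsum_neg_distrib, mul_neg] at h
  exact self_eq_neg.1 h.symm

/-- `K` has to lie in the range of `ρ`, so that `ρ⁻¹(K)` covers all of `K`. This is true of every
subgroup, and for the groups at hand it is seen from explicit preimages of the generators. -/
theorem chebAverage_two_mul (K : Subgroup SO3) [Finite K] (hK : K ≤ rho.range) (l : ℕ) :
    chebAverage K (2 * l) =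
      average fun g : K => (rotChar l (Matrix.trace (g : SO3).1) : ℂ) := by
  have := finite_comap_rho K
  have hs : Function.Surjective (rho.subgroupComap K) := by
    rintro ⟨g, hg⟩
    obtain ⟨p, rfl⟩ := hK hg
    exact ⟨⟨p, hg⟩, rfl⟩
  rw [← average_comp_hom (rho.subgroupComap K) hs, chebAverage]
  congr 1
  ext p
  rw [chebU_two_mul, ← trace_rho]
  rfl

/-! ### Enumeration of a group by cosets -/

section CosetEnumeration

open scoped Pointwise

/-- A family lists a subgroup if it runs through its elements without repetition. -/
def Lists {G κ : Type*} [Group G] (e : κ → G) (N : Subgroup G) : Prop :=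
  Function.Injective e ∧ Set.range e = N

namespace Lists

variable {G κ ι : Type*} [Group G] {e : κ → G} {N : Subgroup G}

theorem mem (h : Lists e N) (k : κ) : e k ∈ N := by
  rw [← SetLike.mem_coe, ← h.2]
  exact ⟨k, rfl⟩

theorem exists_eq (h : Lists e N) {x : G} (hx : x ∈ N) : ∃ k, e k = x := by
  rwa [← SetLike.mem_coe, ← h.2] at hx

theorem finite [Finite κ] (h : Lists e N) : Finite N :=
  Set.finite_coe_iff.2 (h.2 ▸ Set.finite_range e)

theorem average_eq [Fintype κ] (h : Lists e N) (f : G → ℂ) :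
    average (fun x : N => f x) = (Fintype.card κ : ℂ)⁻¹ * ∑ k, f (e k) := by
  have hb : Function.Bijective fun k => (⟨e k, h.mem k⟩ : N) :=
    ⟨fun a b hab => h.1 (congrArg Subtype.val hab), fun x =>
      (h.exists_eq x.2).imp fun _ hk => Subtype.ext hk⟩
  rw [← average_comp_equiv (Equiv.ofBijective _ hb), average_eq_sum, Nat.card_eq_fintype_card]
  rfl

/-- Coset enumeration: if the generators `S` permute the cosets `r i N`, and `r i` and `N` lie in
the group generated by `S`, then that group is the union of these cosets. -/
theorem closure [Finite κ] [Finite ι] (h : Lists e N) {S : Set G} (r : ι → G) (i₀ : ι)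
    (h₀ : r i₀ = 1) (hr : ∀ i, r i ∈ Subgroup.closure S) (hN : N ≤ Subgroup.closure S)
    (hdisj : ∀ i j, i ≠ j → (r i)⁻¹ * r j ∉ N)
    (hS : ∀ s ∈ S, ∀ i, ∃ j, ∃ k, s * r i = r j * e k) :
    Lists (fun x : ι × κ => r x.1 * e x.2) (Subgroup.closure S) := by
  constructor
  · rintro ⟨i, k⟩ ⟨j, l⟩ hij
    have hij : r i * e k = r j * e l := hij
    have hmem : (r i)⁻¹ * r j ∈ N := by
      have : (r i)⁻¹ * r j = e k * (e l)⁻¹ := by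
        rw [eq_mul_inv_iff_mul_eq, mul_assoc, ← hij, inv_mul_cancel_left]
      rw [this]
      exact N.mul_mem (h.mem k) (N.inv_mem (h.mem l))
    obtain rfl : i = j := by
      by_contra hne
      exact hdisj i j hne hmem
    rw [h.1 (mul_left_cancel hij)]
  · -- A generator maps the finite set `E` into itself, so `E` is also stable under its inverse.
    set E := Set.range fun x : ι × κ => r x.1 * e x.2 with hE
    have hfin : E.Finite := Set.finite_range _
    have hle : Subgroup.closure S ≤ MulAction.stabilizer G E := by
      rw [Subgroup.closure_le]
      intro s hs
      refine (MulAction.mem_stabilizer_set_iff_smul_set_subset hfin).2 ?_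
      rintro _ ⟨_, ⟨⟨i, k⟩, rfl⟩, rfl⟩
      obtain ⟨j, l, hjl⟩ := hS s hs i
      obtain ⟨m, hm⟩ := h.exists_eq (N.mul_mem (h.mem l) (h.mem k))
      refine ⟨⟨j, m⟩, ?_⟩
      change r j * e m = s * (r i * e k)
      rw [hm, ← mul_assoc, ← mul_assoc, hjl]
    apply Set.Subset.antisymm
    · rintro _ ⟨⟨i, k⟩, rfl⟩
      exact Subgroup.mul_mem _ (hr i) (hN (h.mem k))
    · intro x hx
      obtain ⟨k, hk⟩ := h.exists_eq N.one_mem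
      have h1 : (1 : G) ∈ E := ⟨⟨i₀, k⟩, by simp [h₀, hk]⟩
      have h2 : x • E = E := MulAction.mem_stabilizer_iff.1 (hle hx)
      rw [← h2]
      exact ⟨1, h1, mul_one x⟩

/-- Coset enumeration with the powers of one element `g` as coset representatives. -/
theorem closure_pow [Finite κ] (h : Lists e N) {S : Set G} (g : G) (m : ℕ) [NeZero m]
    (hg : g ∈ Subgroup.closure S) (hN : N ≤ Subgroup.closure S)
    (hdisj : ∀ i, 0 < i → i < m → g ^ i ∉ N)
    (hS : ∀ s ∈ S, ∀ i : Fin m, ∃ j : Fin m, ∃ k, s * g ^ (i : ℕ) = g ^ (j : ℕ) * e k) :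
    Lists (fun x : Fin m × κ => g ^ (x.1 : ℕ) * e x.2) (Subgroup.closure S) := by
  refine h.closure (fun i : Fin m => g ^ (i : ℕ)) 0 (by simp)
    (fun i => Subgroup.pow_mem _ hg _) hN (fun i j hij hmem => ?_) hS
  have key (a b : ℕ) (hab : a < b) (hb : b < m) (hmem : (g ^ a)⁻¹ * g ^ b ∈ N) : False := by
    refine hdisj (b - a) (by omega) (by omega) ?_
    rwa [pow_sub g hab.le, (Commute.pow_pow_self g b a).inv_right.eq]
  rcases lt_or_gt_of_ne (Fin.val_injective.ne hij) with hlt | hlt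
  · exact key _ _ hlt j.2 hmem
  · exact key _ _ hlt i.2 (by simpa using N.inv_mem hmem)

end Lists

end CosetEnumeration

/-! ### Relations between the generators of the polyhedral groups -/

theorem coe_rotA1 : (rotA1 : Matrix (Fin 3) (Fin 3) ℝ) = !![1, 0, 0; 0, -1, 0; 0, 0, -1] := rfl

theorem coe_rotA2 : (rotA2 : Matrix (Fin 3) (Fin 3) ℝ) = !![-1, 0, 0; 0, 1, 0; 0, 0, -1] := rfl

theorem coe_rotR3 : (rotR3 : Matrix (Fin 3) (Fin 3) ℝ) = !![0, -1, 0; 0, 0, -1; 1, 0, 0] := rfl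

theorem coe_rotR4 : (rotR4 : Matrix (Fin 3) (Fin 3) ℝ) = !![1, 0, 0; 0, 0, -1; 0, 1, 0] := rfl

/-- The matrix of `rotR5` with the factor `1 / 2` moved into the entries. -/
theorem coe_rotR5 : (rotR5 : Matrix (Fin 3) (Fin 3) ℝ) =
    !![(tau - 1) / 2, -tau / 2, 1 / 2; tau / 2, 1 / 2, (tau - 1) / 2;
      -1 / 2, (tau - 1) / 2, tau / 2] := by
  rw [rotR5]
  ext i j
  fin_cases i <;> fin_cases j <;> simp <;> ring

theorem coe_rotR3_sq : ((rotR3 ^ 2 : SO3) : Matrix (Fin 3) (Fin 3) ℝ) =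
    !![0, 0, 1; -1, 0, 0; 0, -1, 0] := by
  rw [pow_two, Submonoid.coe_mul, coe_rotR3]
  simp

theorem coe_rotR5_sq : ((rotR5 ^ 2 : SO3) : Matrix (Fin 3) (Fin 3) ℝ) =
    !![-tau / 2, -1 / 2, (tau - 1) / 2; 1 / 2, (1 - tau) / 2, tau / 2;
      (1 - tau) / 2, tau / 2, 1 / 2] := by
  have h := tau_sq
  rw [pow_two, Submonoid.coe_mul, coe_rotR5]
  ext i j
  fin_cases i <;> fin_cases j <;> simp <;> ring_nf <;> simp only [h] <;> ring

theorem coe_rotR5_pow_three : ((rotR5 ^ 3 : SO3) : Matrix (Fin 3) (Fin 3) ℝ) =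
    !![-tau / 2, 1 / 2, (1 - tau) / 2; -1 / 2, (1 - tau) / 2, tau / 2;
      (tau - 1) / 2, tau / 2, 1 / 2] := by
  have h := tau_sq
  rw [pow_succ, Submonoid.coe_mul, coe_rotR5_sq, coe_rotR5]
  ext i j
  fin_cases i <;> fin_cases j <;> simp <;> ring_nf <;> simp only [h] <;> ring

theorem coe_rotR5_pow_four : ((rotR5 ^ 4 : SO3) : Matrix (Fin 3) (Fin 3) ℝ) =
    !![(tau - 1) / 2, tau / 2, -1 / 2; -tau / 2, 1 / 2, (tau - 1) / 2;
      1 / 2, (tau - 1) / 2, tau / 2] := by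
  have h := tau_sq
  rw [pow_succ, Submonoid.coe_mul, coe_rotR5_pow_three, coe_rotR5]
  ext i j
  fin_cases i <;> fin_cases j <;> simp <;> ring_nf <;> simp only [h] <;> ring

theorem rotR5_pow_five : rotR5 ^ 5 = 1 := by
  have h := tau_sq
  apply Subtype.ext
  rw [pow_succ, Submonoid.coe_mul, coe_rotR5_pow_four, coe_rotR5]
  ext i j
  fin_cases i <;> fin_cases j <;> simp <;> ring_nf <;> simp only [h] <;> ring

theorem rotA1_sq : rotA1 * rotA1 = 1 := by
  apply Subtype.ext
  simp [coe_rotA1, Matrix.one_fin_three]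

theorem rotA2_sq : rotA2 * rotA2 = 1 := by
  apply Subtype.ext
  simp [coe_rotA2, Matrix.one_fin_three]

theorem rotA2_mul_rotA1 : rotA2 * rotA1 = rotA1 * rotA2 := by
  apply Subtype.ext
  simp [coe_rotA1, coe_rotA2]

theorem rotR3_pow_three : rotR3 ^ 3 = 1 := by
  apply Subtype.ext
  rw [pow_succ, Submonoid.coe_mul, coe_rotR3_sq, coe_rotR3]
  simp [Matrix.one_fin_three]

theorem rotR4_sq : rotR4 * rotR4 = rotA1 := by
  apply Subtype.ext
  simp [coe_rotR4, coe_rotA1]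

theorem rotA1_mul_rotR3 : rotA1 * rotR3 = rotR3 * rotA2 := by
  apply Subtype.ext
  simp [coe_rotA1, coe_rotA2, coe_rotR3]

theorem rotA2_mul_rotR3 : rotA2 * rotR3 = rotR3 * (rotA1 * rotA2) := by
  apply Subtype.ext
  simp [coe_rotA1, coe_rotA2, coe_rotR3]

theorem rotA1_mul_rotR3_sq : rotA1 * rotR3 ^ 2 = rotR3 ^ 2 * (rotA1 * rotA2) := by
  apply Subtype.ext
  simp [coe_rotA1, coe_rotA2, coe_rotR3_sq, -SubmonoidClass.coe_pow]

theorem rotA2_mul_rotR3_sq : rotA2 * rotR3 ^ 2 = rotR3 ^ 2 * rotA1 := by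
  apply Subtype.ext
  simp [coe_rotA1, coe_rotA2, coe_rotR3_sq, -SubmonoidClass.coe_pow]

theorem rotA2_mul_rotR4 : rotA2 * rotR4 = rotR4 * (rotA1 * rotA2) := by
  apply Subtype.ext
  simp [coe_rotA1, coe_rotA2, coe_rotR4]

theorem rotR3_mul_rotR4 : rotR3 * rotR4 = rotR4 * (rotR3 ^ 2 * (rotA1 * rotA2)) := by
  apply Subtype.ext
  simp [coe_rotA1, coe_rotA2, coe_rotR3, coe_rotR3_sq, coe_rotR4, -SubmonoidClass.coe_pow]

theorem rotA1_mul_rotR5 : rotA1 * rotR5 = rotR5 ^ 4 * rotA1 := by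
  apply Subtype.ext
  rw [Submonoid.coe_mul, Submonoid.coe_mul, coe_rotR5_pow_four, coe_rotR5, coe_rotA1]
  simp [neg_div]

theorem rotA1_mul_rotR5_sq : rotA1 * rotR5 ^ 2 = rotR5 ^ 3 * rotA1 := by
  apply Subtype.ext
  rw [Submonoid.coe_mul, Submonoid.coe_mul, coe_rotR5_pow_three, coe_rotR5_sq, coe_rotA1]
  simp [neg_div]
  ring_nf
  simp

theorem rotA2_mul_rotR5 : rotA2 * rotR5 = rotR5 ^ 3 * rotR3 := by
  apply Subtype.ext
  rw [Submonoid.coe_mul, Submonoid.coe_mul, coe_rotR5_pow_three, coe_rotR5, coe_rotA2, coe_rotR3]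
  simp [neg_div]
  ring_nf
  simp

theorem rotA2_mul_rotR5_sq : rotA2 * rotR5 ^ 2 = rotR5 ^ 4 * (rotR3 ^ 2 * rotA2) := by
  apply Subtype.ext
  rw [Submonoid.coe_mul, Submonoid.coe_mul, Submonoid.coe_mul, coe_rotR5_pow_four, coe_rotR5_sq,
    coe_rotA2, coe_rotR3_sq]
  simp [neg_div]
  ring_nf
  simp

theorem rotA1_mul_rotR5_pow_three : rotA1 * rotR5 ^ 3 = rotR5 ^ 2 * rotA1 := by
  have h := congrArg (fun x => rotA1 * x * rotA1) rotA1_mul_rotR5_sq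
  simp only [← mul_assoc, rotA1_sq, one_mul] at h
  rw [h, mul_assoc, rotA1_sq, mul_one]

theorem rotA1_mul_rotR5_pow_four : rotA1 * rotR5 ^ 4 = rotR5 * rotA1 := by
  have h := congrArg (fun x => rotA1 * x * rotA1) rotA1_mul_rotR5
  simp only [← mul_assoc, rotA1_sq, one_mul] at h
  rw [h, mul_assoc, rotA1_sq, mul_one]

theorem rotA2_mul_rotR5_pow_three : rotA2 * rotR5 ^ 3 = rotR5 * rotR3 ^ 2 := by
  have h := congrArg (fun x => rotA2 * x * rotR3 ^ 2) rotA2_mul_rotR5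
  simp only [← mul_assoc, rotA2_sq, one_mul] at h
  rw [h, mul_assoc, ← pow_succ', rotR3_pow_three, mul_one]

theorem rotA2_mul_rotR5_pow_four :
    rotA2 * rotR5 ^ 4 = rotR5 ^ 2 * (rotR3 * (rotA1 * rotA2)) := by
  have h := congrArg (fun x => rotA2 * x * (rotA2 * rotR3)) rotA2_mul_rotR5_sq
  simp only [← mul_assoc, rotA2_sq, one_mul] at h
  rw [← rotA2_mul_rotR3, ← mul_assoc, h, mul_assoc _ rotA2 rotA2, rotA2_sq, mul_one, mul_assoc,
    ← pow_succ, rotR3_pow_three, mul_one]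

/-! ### The polyhedral groups -/

/-- The elements of the Klein four group. -/
def kleinElt : Fin 4 → SO3 := ![1, rotA1, rotA2, rotA1 * rotA2]

/-- The elements of the tetrahedral group, by cosets of the Klein four group with the powers of
`rotR3` as representatives. -/
def tetraElt (x : Fin 3 × Fin 4) : SO3 := rotR3 ^ (x.1 : ℕ) * kleinElt x.2

/-- The elements of the octahedral group, by cosets of the tetrahedral group with the powers of
`rotR4` as representatives. -/
def octaElt (x : Fin 2 × Fin 3 × Fin 4) : SO3 := rotR4 ^ (x.1 : ℕ) * tetraElt x.2

/-- The elements of the icosahedral group, by cosets of the tetrahedral group with the powers of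
`rotR5` as representatives. -/
def icosaElt (x : Fin 5 × Fin 3 × Fin 4) : SO3 := rotR5 ^ (x.1 : ℕ) * tetraElt x.2

theorem lists_kleinElt : Lists kleinElt klein := by
  have hA1 : rotA1 ∈ klein := Subgroup.subset_closure (by simp)
  have hA2 : rotA2 ∈ klein := Subgroup.subset_closure (by simp)
  have hinj : Function.Injective kleinElt := by
    intro i j hij
    have h0 := congrFun (congrFun (congrArg Subtype.val hij) 0) 0
    have h1 := congrFun (congrFun (congrArg Subtype.val hij) 1) 1
    fin_cases i <;> fin_cases j <;>
      first
        | rfl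
        | (norm_num [kleinElt, coe_rotA1, coe_rotA2] at h0; done)
        | norm_num [kleinElt, coe_rotA1, coe_rotA2] at h1
  have hbot : Lists (fun _ : Unit => (1 : SO3)) ⊥ := ⟨fun _ _ _ => rfl, by simp⟩
  have h := hbot.closure (S := {rotA1, rotA2}) kleinElt 0 rfl ?_ bot_le ?_ ?_
  · refine ⟨hinj, Eq.trans ?_ h.2⟩
    ext x
    simp
  · intro i
    fin_cases i
    exacts [one_mem _, hA1, hA2, mul_mem hA1 hA2]
  · intro i j hij hmem
    exact hij (hinj (inv_mul_eq_one.1 (Subgroup.mem_bot.1 hmem)))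
  · rintro _ (rfl | rfl) i <;> fin_cases i
    · exact ⟨1, (), by simp [kleinElt]⟩
    · exact ⟨0, (), by simp [kleinElt, rotA1_sq]⟩
    · exact ⟨3, (), by simp [kleinElt]⟩
    · exact ⟨2, (), by simp [kleinElt, ← mul_assoc, rotA1_sq]⟩
    · exact ⟨2, (), by simp [kleinElt]⟩
    · exact ⟨3, (), by simp [kleinElt, rotA2_mul_rotA1]⟩
    · exact ⟨0, (), by simp [kleinElt, rotA2_sq]⟩
    · exact ⟨1, (), by simp [kleinElt, ← rotA2_mul_rotA1, ← mul_assoc, rotA2_sq]⟩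

theorem lists_tetraElt : Lists tetraElt tetrahedral := by
  have hA1 : rotA1 ∈ tetrahedral := Subgroup.subset_closure (by simp)
  have hA2 : rotA2 ∈ tetrahedral := Subgroup.subset_closure (by simp)
  have hR3 : rotR3 ∈ tetrahedral := Subgroup.subset_closure (by simp)
  -- This entry separates the powers of `rotR3` from the Klein four group.
  have hentry (x : SO3) (hx : x ∈ klein) : (x : Matrix (Fin 3) (Fin 3) ℝ) 0 0 ≠ 0 := by
    obtain ⟨k, rfl⟩ := lists_kleinElt.exists_eq hx
    fin_cases k <;> simp [kleinElt, coe_rotA1, coe_rotA2]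
  refine lists_kleinElt.closure_pow rotR3 3 hR3 ?_ ?_ ?_
  · rw [klein, Subgroup.closure_le]
    rintro _ (rfl | rfl)
    exacts [hA1, hA2]
  · intro i h0 h3 hi
    have := hentry _ hi
    interval_cases i
    · simp [coe_rotR3] at this
    · simp [coe_rotR3_sq, -SubmonoidClass.coe_pow] at this
  · rintro _ (rfl | rfl | rfl) i <;> fin_cases i
    · exact ⟨0, 1, by simp [kleinElt]⟩
    · exact ⟨1, 2, by simp [kleinElt, rotA1_mul_rotR3]⟩
    · exact ⟨2, 3, by simp [kleinElt, rotA1_mul_rotR3_sq]⟩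
    · exact ⟨0, 2, by simp [kleinElt]⟩
    · exact ⟨1, 3, by simp [kleinElt, rotA2_mul_rotR3]⟩
    · exact ⟨2, 1, by simp [kleinElt, rotA2_mul_rotR3_sq]⟩
    · exact ⟨1, 0, by simp [kleinElt]⟩
    · exact ⟨2, 0, by simp [kleinElt, pow_two]⟩
    · exact ⟨0, 0, by simp [kleinElt, ← pow_succ', rotR3_pow_three]⟩

theorem lists_octaElt : Lists octaElt octahedral := by
  have hA2 : rotA2 ∈ octahedral := Subgroup.subset_closure (by simp)
  have hR3 : rotR3 ∈ octahedral := Subgroup.subset_closure (by simp)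
  have hR4 : rotR4 ∈ octahedral := Subgroup.subset_closure (by simp)
  -- The tetrahedral group permutes the axes evenly, unlike `rotR4`, which fixes just one axis.
  have hentry (x : SO3) (hx : x ∈ tetrahedral) (h0 : (x : Matrix (Fin 3) (Fin 3) ℝ) 0 0 = 1) :
      (x : Matrix (Fin 3) (Fin 3) ℝ) 1 2 = 0 := by
    obtain ⟨⟨j, k⟩, rfl⟩ := lists_tetraElt.exists_eq hx
    fin_cases j <;> fin_cases k <;>
      simp [tetraElt, kleinElt, coe_rotA1, coe_rotA2, coe_rotR3, coe_rotR3_sq,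
        -SubmonoidClass.coe_pow] at h0 ⊢
  refine lists_tetraElt.closure_pow rotR4 2 hR4 ?_ ?_ ?_
  · rw [tetrahedral, Subgroup.closure_le]
    rintro _ (rfl | rfl | rfl)
    exacts [rotR4_sq ▸ octahedral.mul_mem hR4 hR4, hA2, hR3]
  · intro i h0 h3 hi
    have := hentry _ hi
    interval_cases i
    simp [coe_rotR4] at this
  · rintro _ (rfl | rfl | rfl) i <;> fin_cases i
    · exact ⟨0, (0, 2), by simp [kleinElt, tetraElt]⟩
    · exact ⟨1, (0, 3), by simp [kleinElt, tetraElt, rotA2_mul_rotR4]⟩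
    · exact ⟨0, (1, 0), by simp [kleinElt, tetraElt]⟩
    · exact ⟨1, (2, 3), by simp [kleinElt, tetraElt, rotR3_mul_rotR4]⟩
    · exact ⟨1, (0, 0), by simp [kleinElt, tetraElt]⟩
    · exact ⟨0, (0, 1), by simp [kleinElt, tetraElt, rotR4_sq]⟩

theorem one_lt_tau : 1 < tau := by
  have h := tau_sq
  have h0 : 0 < tau := by unfold tau; positivity
  nlinarith

theorem tau_lt_two : tau < 2 := by
  have h := tau_sq
  have h0 := one_lt_tau
  nlinarith

theorem lists_icosaElt : Lists icosaElt icosahedral := by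
  have hA1 : rotA1 ∈ icosahedral := Subgroup.subset_closure (by simp)
  have hA2 : rotA2 ∈ icosahedral := Subgroup.subset_closure (by simp)
  have hR5 : rotR5 ∈ icosahedral := Subgroup.subset_closure (by simp)
  have hR3 : rotR3 ∈ icosahedral := by
    rw [← inv_mul_eq_iff_eq_mul.2 rotA2_mul_rotR5]
    exact icosahedral.mul_mem (icosahedral.inv_mem (icosahedral.pow_mem hR5 3))
      (icosahedral.mul_mem hA2 hR5)
  -- The matrices in the tetrahedral group are integral, unlike the nontrivial powers of `rotR5`.
  have hentry (x : SO3) (hx : x ∈ tetrahedral) : (x : Matrix (Fin 3) (Fin 3) ℝ) 0 0 = 0 ∨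
      (x : Matrix (Fin 3) (Fin 3) ℝ) 0 0 = 1 ∨ (x : Matrix (Fin 3) (Fin 3) ℝ) 0 0 = -1 := by
    obtain ⟨⟨j, k⟩, rfl⟩ := lists_tetraElt.exists_eq hx
    fin_cases j <;> fin_cases k <;>
      simp [tetraElt, kleinElt, coe_rotA1, coe_rotA2, coe_rotR3, coe_rotR3_sq,
        -SubmonoidClass.coe_pow]
  refine lists_tetraElt.closure_pow rotR5 5 hR5 ?_ ?_ ?_
  · rw [tetrahedral, Subgroup.closure_le]
    rintro _ (rfl | rfl | rfl)
    exacts [hA1, hA2, hR3]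
  · intro i h0 h5 hi
    have h1 := one_lt_tau
    have h2 := tau_lt_two
    have := hentry _ hi
    interval_cases i
    · rw [pow_one, coe_rotR5] at this
      rcases this with h | h | h <;> simp at h <;> linarith
    · rw [coe_rotR5_sq] at this
      rcases this with h | h | h <;> simp at h <;> linarith
    · rw [coe_rotR5_pow_three] at this
      rcases this with h | h | h <;> simp at h <;> linarith
    · rw [coe_rotR5_pow_four] at this
      rcases this with h | h | h <;> simp at h <;> linarith
  · rintro _ (rfl | rfl | rfl) i <;> fin_cases i
    · exact ⟨0, (0, 1), by simp [kleinElt, tetraElt]⟩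
    · exact ⟨4, (0, 1), by simp [kleinElt, tetraElt, rotA1_mul_rotR5]⟩
    · exact ⟨3, (0, 1), by simp [kleinElt, tetraElt, rotA1_mul_rotR5_sq]⟩
    · exact ⟨2, (0, 1), by simp [kleinElt, tetraElt, rotA1_mul_rotR5_pow_three]⟩
    · exact ⟨1, (0, 1), by simp [kleinElt, tetraElt, rotA1_mul_rotR5_pow_four]⟩
    · exact ⟨0, (0, 2), by simp [kleinElt, tetraElt]⟩
    · exact ⟨3, (1, 0), by simp [kleinElt, tetraElt, rotA2_mul_rotR5]⟩
    · exact ⟨4, (2, 2), by simp [kleinElt, tetraElt, rotA2_mul_rotR5_sq]⟩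
    · exact ⟨1, (2, 0), by simp [kleinElt, tetraElt, rotA2_mul_rotR5_pow_three]⟩
    · exact ⟨2, (1, 3), by simp [kleinElt, tetraElt, rotA2_mul_rotR5_pow_four]⟩
    · exact ⟨1, (0, 0), by simp [kleinElt, tetraElt]⟩
    · exact ⟨2, (0, 0), by simp [kleinElt, tetraElt, pow_two]⟩
    · exact ⟨3, (0, 0), by simp [kleinElt, tetraElt, ← pow_succ']⟩
    · exact ⟨4, (0, 0), by simp [kleinElt, tetraElt, ← pow_succ']⟩
    · exact ⟨0, (0, 0), by simp [kleinElt, tetraElt, ← pow_succ', rotR5_pow_five]⟩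

/-! ### Averages of characters over the polyhedral groups -/

theorem sum_trace_kleinElt (f : ℝ → ℂ) :
    ∑ x, f (Matrix.trace (kleinElt x).1) = f 3 + 3 * f (-1) := by
  simp only [Fin.sum_univ_four, kleinElt, Matrix.trace_fin_three]
  simp [coe_rotA1, coe_rotA2]
  norm_num
  ring

/-- The traces on a coset `g T` of the tetrahedral group: the elements of `T` are the
matrices of determinant one that permute the axes cyclically up to sign. -/
theorem sum_trace_mul_tetraElt (f : ℝ → ℂ) (g : SO3) {a b c d e k p q r : ℝ}
    (hg : g.1 = !![a, b, c; d, e, k; p, q, r]) :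
    ∑ x, f (Matrix.trace (g * tetraElt x).1) =
      f (a + e + r) + f (a - e - r) + f (-a + e - r) + f (-a - e + r) +
      f (c - d - q) + f (c + d + q) + f (-c - d + q) + f (-c + d - q) +
      f (-b - k + p) + f (b - k - p) + f (-b + k - p) + f (b + k + p) := by
  simp only [Fintype.sum_prod_type, Fin.sum_univ_four, Fin.sum_univ_three, Matrix.trace_fin_three,
    tetraElt, kleinElt, Submonoid.coe_mul, hg]
  simp [coe_rotA1, coe_rotA2, coe_rotR3, coe_rotR3_sq, -SubmonoidClass.coe_pow, Matrix.mul_apply,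
    Fin.sum_univ_three]
  ring_nf

theorem sum_trace_tetraElt (f : ℝ → ℂ) :
    ∑ x, f (Matrix.trace (tetraElt x).1) = f 3 + 3 * f (-1) + 8 * f 0 := by
  have h := sum_trace_mul_tetraElt f 1 (a := 1) (b := 0) (c := 0) (d := 0) (e := 1) (k := 0)
    (p := 0) (q := 0) (r := 1) Matrix.one_fin_three
  simp only [one_mul] at h
  rw [h]
  norm_num
  ring

theorem sum_trace_octaElt (f : ℝ → ℂ) :
    ∑ x, f (Matrix.trace (octaElt x).1) = f 3 + 9 * f (-1) + 8 * f 0 + 6 * f 1 := by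
  simp only [octaElt, Fintype.sum_prod_type (f := fun x : Fin 2 × Fin 3 × Fin 4 => _),
    Fin.sum_univ_two]
  simp only [Fin.val_zero, Fin.val_one, pow_zero, pow_one, one_mul]
  rw [sum_trace_tetraElt, sum_trace_mul_tetraElt f rotR4 coe_rotR4]
  norm_num
  ring

theorem sum_trace_icosaElt (f : ℝ → ℂ) :
    ∑ x, f (Matrix.trace (icosaElt x).1) =
      f 3 + 15 * f (-1) + 20 * f 0 + 12 * f tau + 12 * f (1 - tau) := by
  simp only [icosaElt, Fintype.sum_prod_type (f := fun x : Fin 5 × Fin 3 × Fin 4 => _),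
    Fin.sum_univ_five]
  simp only [Fin.val_zero, Fin.val_one, Fin.val_two,
    show ((3 : Fin 5) : ℕ) = 3 from rfl, show ((4 : Fin 5) : ℕ) = 4 from rfl,
    pow_zero, pow_one, one_mul]
  rw [sum_trace_tetraElt, sum_trace_mul_tetraElt f rotR5 coe_rotR5,
    sum_trace_mul_tetraElt f (rotR5 ^ 2) coe_rotR5_sq,
    sum_trace_mul_tetraElt f (rotR5 ^ 3) coe_rotR5_pow_three,
    sum_trace_mul_tetraElt f (rotR5 ^ 4) coe_rotR5_pow_four]
  ring_nf

/-- The real part of the preimage `a` is determined up to sign by the trace `4 a₀² - 1` of the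
rotation. If it is not `0`, the antisymmetric part of the matrix determines the other coordinates. -/
theorem exists_rho_eq {g : SO3} (a : Fin 4 → ℝ)
    (ha : a 0 ^ 2 + a 1 ^ 2 + a 2 ^ 2 + a 3 ^ 2 = 1) (hg : rhoMat (quatMat a) = g.1) :
    g ∈ rho.range :=
  ⟨⟨quatMat a, quatMat_mem ha⟩, Subtype.ext hg⟩

theorem rotA1_mem_range : rotA1 ∈ rho.range := by
  refine exists_rho_eq ![0, 1, 0, 0] (by simp) ?_
  rw [rhoMat_quatMat, coe_rotA1]
  simp

theorem rotA2_mem_range : rotA2 ∈ rho.range := by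
  refine exists_rho_eq ![0, 0, 1, 0] (by simp) ?_
  rw [rhoMat_quatMat, coe_rotA2]
  simp

theorem rotR3_mem_range : rotR3 ∈ rho.range := by
  refine exists_rho_eq ![1 / 2, 1 / 2, -1 / 2, 1 / 2] (by simp; norm_num) ?_
  rw [rhoMat_quatMat, coe_rotR3]
  ext i j
  fin_cases i <;> fin_cases j <;> simp <;> norm_num

theorem rotR4_mem_range : rotR4 ∈ rho.range := by
  have h : √2 ^ 2 = (2 : ℝ) := Real.sq_sqrt (by norm_num)
  refine exists_rho_eq ![√2 / 2, √2 / 2, 0, 0] ?_ ?_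
  · simp [div_pow]
    norm_num
  · rw [rhoMat_quatMat, coe_rotR4]
    simp [div_pow]
    ring_nf
    norm_num

theorem rotR5_mem_range : rotR5 ∈ rho.range := by
  have h := tau_sq
  refine exists_rho_eq ![tau / 2, 0, (tau - 1) / 2, 1 / 2] ?_ ?_
  · simp
    linear_combination h / 2
  · rw [rhoMat_quatMat, coe_rotR5]
    ext i j
    fin_cases i <;> fin_cases j <;> simp <;> ring_nf <;> simp only [h] <;> ring

theorem klein_le_range : klein ≤ rho.range := by
  rw [klein, Subgroup.closure_le]
  rintro _ (rfl | rfl)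
  exacts [rotA1_mem_range, rotA2_mem_range]

theorem tetrahedral_le_range : tetrahedral ≤ rho.range := by
  rw [tetrahedral, Subgroup.closure_le]
  rintro _ (rfl | rfl | rfl)
  · exact rotA1_mem_range
  · exact rotA2_mem_range
  · exact rotR3_mem_range

theorem octahedral_le_range : octahedral ≤ rho.range := by
  rw [octahedral, Subgroup.closure_le]
  rintro _ (rfl | rfl | rfl)
  · exact rotA2_mem_range
  · exact rotR3_mem_range
  · exact rotR4_mem_range

theorem icosahedral_le_range : icosahedral ≤ rho.range := by
  rw [icosahedral, Subgroup.closure_le]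
  rintro _ (rfl | rfl | rfl)
  · exact rotA1_mem_range
  · exact rotA2_mem_range
  · exact rotR5_mem_range

theorem chebAverage_of_lists {κ : Type*} [Fintype κ] {e : κ → SO3} {K : Subgroup SO3}
    (h : Lists e K) (hK : K ≤ rho.range) (l : ℕ) :
    chebAverage K (2 * l) =
      (Fintype.card κ : ℂ)⁻¹ * ∑ k, (rotChar l (Matrix.trace (e k).1) : ℂ) := by
  have := h.finite
  rw [chebAverage_two_mul K hK, h.average_eq fun g => (rotChar l (Matrix.trace g.1) : ℂ)]

theorem chebAverage_klein (l : ℕ) : chebAverage klein (2 * l) =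
    (4 : ℂ)⁻¹ * (rotChar l 3 + 3 * rotChar l (-1) : ℝ) := by
  rw [chebAverage_of_lists lists_kleinElt klein_le_range,
    sum_trace_kleinElt fun x => (rotChar l x : ℂ)]
  simp

theorem chebAverage_tetrahedral (l : ℕ) : chebAverage tetrahedral (2 * l) =
    (12 : ℂ)⁻¹ * (rotChar l 3 + 3 * rotChar l (-1) + 8 * rotChar l 0 : ℝ) := by
  rw [chebAverage_of_lists lists_tetraElt tetrahedral_le_range,
    sum_trace_tetraElt fun x => (rotChar l x : ℂ)]
  norm_num

theorem chebAverage_octahedral (l : ℕ) : chebAverage octahedral (2 * l) =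
    (24 : ℂ)⁻¹ * (rotChar l 3 + 9 * rotChar l (-1) + 8 * rotChar l 0 + 6 * rotChar l 1 : ℝ) := by
  rw [chebAverage_of_lists lists_octaElt octahedral_le_range,
    sum_trace_octaElt fun x => (rotChar l x : ℂ)]
  norm_num

theorem chebAverage_icosahedral (l : ℕ) : chebAverage icosahedral (2 * l) =
    (60 : ℂ)⁻¹ * (rotChar l 3 + 15 * rotChar l (-1) + 20 * rotChar l 0 + 12 * rotChar l tau +
      12 * rotChar l (1 - tau) : ℝ) := by
  rw [chebAverage_of_lists lists_icosaElt icosahedral_le_range,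
    sum_trace_icosaElt fun x => (rotChar l x : ℂ)]
  norm_num

theorem rotChar_three (l : ℕ) : rotChar l 3 = 2 * l + 1 := by
  induction l using Nat.strong_induction_on with
  | _ l ih =>
    rcases l with _ | _ | l
    · simp [rotChar]
    · norm_num [rotChar]
    · rw [rotChar, ih l (by omega), ih (l + 1) (by omega)]
      push_cast
      ring

/-- The characters at a rotation of order five, whose trace is a root of `x² = x + 1`. -/
theorem rotChar_of_sq_eq {x : ℝ} (h : x ^ 2 = x + 1) :
    rotChar 2 x = 0 ∧ rotChar 3 x = -x ∧ rotChar 4 x = -1 ∧ rotChar 5 x = 1 ∧ rotChar 6 x = x ∧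
      rotChar 7 x = 0 := by
  have h2 : rotChar 2 x = 0 := by
    simp only [rotChar]
    linear_combination h
  have h3 : rotChar 3 x = -x := by rw [rotChar, h2, rotChar]; ring
  have h4 : rotChar 4 x = -1 := by rw [rotChar, h3, h2]; linear_combination -h
  have h5 : rotChar 5 x = 1 := by rw [rotChar, h4, h3]; ring
  have h6 : rotChar 6 x = x := by rw [rotChar, h5, h4]; ring
  have h7 : rotChar 7 x = 0 := by rw [rotChar, h6, h5]; linear_combination h
  exact ⟨h2, h3, h4, h5, h6, h7⟩

theorem chebAverage_klein_values (l : Fin 8) :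
    chebAverage klein (2 * (l : ℕ)) = ((![1, 0, 2, 1, 3, 2, 4, 3] : Fin 8 → ℕ) l : ℂ) := by
  rw [chebAverage_klein, rotChar_three]
  fin_cases l <;> norm_num [rotChar]

theorem chebAverage_tetrahedral_values (l : Fin 8) :
    chebAverage tetrahedral (2 * (l : ℕ)) = ((![1, 0, 0, 1, 1, 0, 2, 1] : Fin 8 → ℕ) l : ℂ) := by
  rw [chebAverage_tetrahedral, rotChar_three]
  fin_cases l <;> norm_num [rotChar]

theorem chebAverage_octahedral_values (l : Fin 8) :
    chebAverage octahedral (2 * (l : ℕ)) = ((![1, 0, 0, 0, 1, 0, 1, 0] : Fin 8 → ℕ) l : ℂ) := by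
  rw [chebAverage_octahedral, rotChar_three]
  fin_cases l <;> norm_num [rotChar]

theorem chebAverage_icosahedral_values (l : Fin 8) :
    chebAverage icosahedral (2 * (l : ℕ)) = ((![1, 0, 0, 0, 0, 0, 1, 0] : Fin 8 → ℕ) l : ℂ) := by
  obtain ⟨a2, a3, a4, a5, a6, a7⟩ := rotChar_of_sq_eq tau_sq
  obtain ⟨b2, b3, b4, b5, b6, b7⟩ := rotChar_of_sq_eq (x := 1 - tau)
    (by linear_combination tau_sq)
  have h : chebAverage icosahedral (2 * (l : ℕ)) = (60 : ℂ)⁻¹ *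
      (![60, 0, 0, 0, 0, 0, 60, 0] l : ℝ) := by
    rw [chebAverage_icosahedral, rotChar_three]
    congr 2
    fin_cases l <;> simp [a2, a3, a4, a5, a6, a7, b2, b3, b4, b5, b6, b7] <;> simp [rotChar] <;>
      ring
  rw [h]
  fin_cases l <;> simp

theorem coeff_molienSeries_biGroup_two_mul (K : Subgroup SO3) [Finite (K.comap rho)] (k : ℕ) :
    PowerSeries.coeff (2 * k) (molienSeries (biGroup K)) =
      ∑ l ∈ Finset.range (k + 1), chebAverage K (2 * l) ^ 2 := by
  induction k with
  | zero => simp [coeff_molienSeries_biGroup_of_lt_two]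
  | succ k ih =>
    rw [Finset.sum_range_succ, ← ih, Nat.mul_succ, coeff_molienSeries_biGroup_add_two]

theorem coeff_molienSeries_biGroup_of_odd (K : Subgroup SO3) [Finite (K.comap rho)] {n : ℕ}
    (hn : Odd n) : PowerSeries.coeff n (molienSeries (biGroup K)) = 0 := by
  obtain ⟨k, rfl⟩ := hn
  induction k with
  | zero =>
    rw [coeff_molienSeries_biGroup_of_lt_two K (by omega), chebAverage_of_odd K (by simp)]
    simp
  | succ k ih =>
    rw [show 2 * (k + 1) + 1 = 2 * k + 1 + 2 by ring, coeff_molienSeries_biGroup_add_two, ih,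
      chebAverage_of_odd K ⟨k + 1, by ring⟩]
    simp

/-! ### Dimensions of the spaces of invariants -/

theorem trunc_two_mul_of_coeff_odd_eq_zero {R : Type*} [CommSemiring R] (φ : PowerSeries R)
    (h : ∀ k, PowerSeries.coeff (2 * k + 1) φ = 0) (n : ℕ) :
    PowerSeries.trunc (2 * n) φ =
      ∑ k ∈ Finset.range n, Polynomial.monomial (2 * k) (PowerSeries.coeff (2 * k) φ) := by
  induction n with
  | zero => simp
  | succ n ih =>
    rw [Nat.mul_succ, PowerSeries.trunc_succ, PowerSeries.trunc_succ, ih, Finset.sum_range_succ, h,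
      map_zero, add_zero]

/-- Here `v l` is the dimension of the `K`-invariants in the irreducible representation of `SO(3)`
of dimension `2 l + 1`, and the dimension `w k` of the invariants of degree `2 k` is the sum of the
squares of the first of these. -/
theorem coeff_molienSeries_biGroup_of_values (K : Subgroup SO3) [Finite (K.comap rho)]
    {v w : Fin 8 → ℕ} (hv : ∀ l : Fin 8, chebAverage K (2 * (l : ℕ)) = v l)
    (hw : ∀ k, ∑ l ∈ Finset.Iic k, v l ^ 2 = w k) (k : Fin 8) :
    PowerSeries.coeff (2 * (k : ℕ)) (molienSeries (biGroup K)) = w k := by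
  rw [coeff_molienSeries_biGroup_two_mul, Nat.range_succ_eq_Iic, ← Fin.map_valEmbedding_Iic,
    Finset.sum_map, ← hw]
  simp [hv]

theorem trunc_molienSeries_biGroup_of_values (K : Subgroup SO3) [Finite (K.comap rho)]
    {v w : Fin 8 → ℕ} (hv : ∀ l : Fin 8, chebAverage K (2 * (l : ℕ)) = v l)
    (hw : ∀ k, ∑ l ∈ Finset.Iic k, v l ^ 2 = w k) :
    PowerSeries.trunc 16 (molienSeries (biGroup K)) =
      ∑ k : Fin 8, (w k : Polynomial ℂ) * Polynomial.X ^ (2 * (k : ℕ)) := by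
  rw [show 16 = 2 * 8 from rfl, trunc_two_mul_of_coeff_odd_eq_zero _
    fun k => coeff_molienSeries_biGroup_of_odd K ⟨k, rfl⟩, Finset.sum_range]
  simp only [coeff_molienSeries_biGroup_of_values K hv hw, ← Polynomial.C_mul_X_pow_eq_monomial,
    map_natCast]

theorem finrank_invariants_biGroup_of_values (K : Subgroup SO3) [Finite (K.comap rho)]
    {v w : Fin 8 → ℕ} (hv : ∀ l : Fin 8, chebAverage K (2 * (l : ℕ)) = v l)
    (hw : ∀ k, ∑ l ∈ Finset.Iic k, v l ^ 2 = w k) (k : Fin 8) :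
    Module.finrank ℂ (invariants (biGroup K) (2 * (k : ℕ))) = w k := by
  have := finite_biGroup K
  have h := coeff_molienSeries_biGroup_of_values K hv hw k
  rw [← poincareSeries_eq_molienSeries, poincareSeries, PowerSeries.coeff_mk] at h
  exact_mod_cast h

theorem invariants_eq_bot_of_odd (K : Subgroup SO3) [Finite (K.comap rho)] {j : ℕ} (hj : Odd j) :
    invariants (biGroup K) j = ⊥ := by
  have := finite_biGroup K
  have h := coeff_molienSeries_biGroup_of_odd K hj
  rw [← poincareSeries_eq_molienSeries, poincareSeries, PowerSeries.coeff_mk] at h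
  exact Submodule.finrank_eq_zero.1 (Nat.cast_eq_zero.1 h)

instance finite_comap_klein : Finite (klein.comap rho) :=
  have := lists_kleinElt.finite
  finite_comap_rho klein

instance finite_comap_tetrahedral : Finite (tetrahedral.comap rho) :=
  have := lists_tetraElt.finite
  finite_comap_rho tetrahedral

instance finite_comap_octahedral : Finite (octahedral.comap rho) :=
  have := lists_octaElt.finite
  finite_comap_rho octahedral

instance finite_comap_icosahedral : Finite (icosahedral.comap rho) :=
  have := lists_icosaElt.finite
  finite_comap_rho icosahedral

theorem trunc_molienSeries_groupH : PowerSeries.trunc 16 (molienSeries groupH) =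
    1 + Polynomial.X ^ 2 + 5 * Polynomial.X ^ 4 + 6 * Polynomial.X ^ 6 +
      15 * Polynomial.X ^ 8 + 19 * Polynomial.X ^ 10 + 35 * Polynomial.X ^ 12 +
      44 * Polynomial.X ^ 14 := by
  rw [groupH, trunc_molienSeries_biGroup_of_values klein chebAverage_klein_values
    (w := ![1, 1, 5, 6, 15, 19, 35, 44]) (by decide)]
  simp [Fin.sum_univ_eight]

theorem trunc_molienSeries_group6 : PowerSeries.trunc 16 (molienSeries group6) =
    1 + Polynomial.X ^ 2 + Polynomial.X ^ 4 + 2 * Polynomial.X ^ 6 +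
      3 * Polynomial.X ^ 8 + 3 * Polynomial.X ^ 10 + 7 * Polynomial.X ^ 12 +
      8 * Polynomial.X ^ 14 := by
  rw [group6, trunc_molienSeries_biGroup_of_values tetrahedral chebAverage_tetrahedral_values
    (w := ![1, 1, 1, 2, 3, 3, 7, 8]) (by decide)]
  simp [Fin.sum_univ_eight]

theorem trunc_molienSeries_group8 : PowerSeries.trunc 16 (molienSeries group8) =
    1 + Polynomial.X ^ 2 + Polynomial.X ^ 4 + Polynomial.X ^ 6 +
      2 * Polynomial.X ^ 8 + 2 * Polynomial.X ^ 10 + 3 * Polynomial.X ^ 12 +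
      3 * Polynomial.X ^ 14 := by
  rw [group8, trunc_molienSeries_biGroup_of_values octahedral chebAverage_octahedral_values
    (w := ![1, 1, 1, 1, 2, 2, 3, 3]) (by decide)]
  simp [Fin.sum_univ_eight]

theorem trunc_molienSeries_group12 : PowerSeries.trunc 16 (molienSeries group12) =
    1 + Polynomial.X ^ 2 + Polynomial.X ^ 4 + Polynomial.X ^ 6 +
      Polynomial.X ^ 8 + Polynomial.X ^ 10 + 2 * Polynomial.X ^ 12 +
      2 * Polynomial.X ^ 14 := by
  rw [group12, trunc_molienSeries_biGroup_of_values icosahedral chebAverage_icosahedral_values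
    (w := ![1, 1, 1, 1, 1, 1, 2, 2]) (by decide)]
  simp [Fin.sum_univ_eight]

/-! ### The second invariant -/

section SecondInvariant

open MvPolynomial

/-- If `S` is not a multiple of `Q ^ m` and has the same degree, then `Q` and `S` are algebraically
independent: a homogeneous relation between them, divided by a power of `Q`, would be an algebraic
equation over the algebraically closed field `k` for the rational function `S / Q ^ m`. -/
theorem algebraicIndependent_pair_of_isHomogeneous {k ι : Type*} [Field k] [IsAlgClosed k]
    {Q S : MvPolynomial ι k} {d m : ℕ} (hd : 0 < d) (hQ0 : Q ≠ 0) (hQ : Q.IsHomogeneous d)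
    (hS : S.IsHomogeneous (d * m)) (hQS : LinearIndependent k ![Q ^ m, S]) :
    AlgebraicIndependent k ![Q, S] := by
  classical
  rw [algebraicIndependent_iff]
  intro p hp
  by_contra hp0
  obtain ⟨s₀, hs₀⟩ := MvPolynomial.ne_zero_iff.1 hp0
  set D := s₀ 0 + m * s₀ 1 with hD
  set F := p.support.filter fun s => s 0 + m * s 1 = D with hF
  have hsum : ∑ s ∈ F, C (coeff s p) * (Q ^ s 0 * S ^ s 1) = 0 := by
    have h := congrArg (homogeneousComponent (d * D)) hp
    rw [aeval_def, eval₂_eq', map_sum, map_zero] at h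
    rw [← h, hF, Finset.sum_filter]
    refine Finset.sum_congr rfl fun s _ => ?_
    have hhom : (C (coeff s p) * (Q ^ s 0 * S ^ s 1)).IsHomogeneous (d * (s 0 + m * s 1)) := by
      have := (isHomogeneous_C ι (coeff s p)).mul ((hQ.pow (s 0)).mul (hS.pow (s 1)))
      convert! this using 1
      ring
    simp only [Fin.prod_univ_two, Matrix.cons_val_zero, Matrix.cons_val_one, algebraMap_eq]
    rw [homogeneousComponent_of_mem hhom]
    simp [hd.ne', eq_comm]
  let L := FractionRing (MvPolynomial ι k)
  let φ : MvPolynomial ι k →ₐ[k] L := Algebra.algHom k (MvPolynomial ι k) L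
  have hφ : Function.Injective φ := IsFractionRing.injective (MvPolynomial ι k) L
  have hφQ : φ Q ≠ 0 := (map_ne_zero_iff φ hφ).2 hQ0
  set r : L := φ S / φ Q ^ m with hr
  have hφS : φ S = r * φ Q ^ m := (div_mul_cancel₀ _ (pow_ne_zero _ hφQ)).symm
  set P : Polynomial k := ∑ s ∈ F, Polynomial.monomial (s 1) (coeff s p) with hP
  have hP0 : P ≠ 0 := by
    intro h0
    have h1 := congrArg (fun q => Polynomial.coeff q (s₀ 1)) h0
    simp only [hP, Polynomial.finsetSum_coeff, Polynomial.coeff_monomial, Polynomial.coeff_zero]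
      at h1
    rw [Finset.sum_eq_single s₀, if_pos rfl] at h1
    · exact hs₀ h1
    · intro s hs hne
      refine if_neg fun h => hne ?_
      have h2 : s 0 + m * s 1 = D := (Finset.mem_filter.1 hs).2
      ext i
      fin_cases i
      · change s 0 = s₀ 0
        rw [h] at h2
        omega
      · exact h
    · intro h
      exact (h (Finset.mem_filter.2 ⟨mem_support_iff.2 hs₀, rfl⟩)).elim
  have hPr : Polynomial.aeval r P = 0 := by
    have h := congrArg φ hsum
    have hterm (s) (hs : s ∈ F) : φ (C (coeff s p) * (Q ^ s 0 * S ^ s 1)) =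
        φ Q ^ D * Polynomial.aeval r (Polynomial.monomial (s 1) (coeff s p)) := by
      have h2 : s 0 + m * s 1 = D := (Finset.mem_filter.1 hs).2
      rw [map_mul, map_mul, map_pow, map_pow, hφS, ← h2, Polynomial.aeval_monomial, ← algebraMap_eq,
        AlgHom.commutes]
      ring
    rw [map_zero, map_sum, Finset.sum_congr rfl hterm, ← Finset.mul_sum, ← map_sum] at h
    exact (mul_eq_zero.1 h).resolve_left (pow_ne_zero _ hφQ)
  have hint : IsIntegral k r := isAlgebraic_iff_isIntegral.1 ⟨P, hP0, hPr⟩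
  obtain ⟨c, hc⟩ := minpoly.degree_eq_one_iff.1
    (IsAlgClosed.degree_eq_one_of_irreducible k (minpoly.irreducible hint))
  have hSc : c • Q ^ m = S := by
    apply hφ
    rw [map_smul, map_pow, hφS, Algebra.smul_def]
    exact congrArg (· * φ Q ^ m) hc
  exact (LinearIndependent.pair_iff' (pow_ne_zero m hQ0)).1 hQS c hSc

theorem isHomogeneous_quadQ : quadQ.IsHomogeneous 2 :=
  IsHomogeneous.sum _ _ _ fun i _ => by simpa using (isHomogeneous_X ℂ i).pow 2

theorem quadQ_ne_zero : quadQ ≠ 0 := by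
  intro h
  have := congrArg (MvPolynomial.eval (Pi.single 0 1)) h
  simp [quadQ, Pi.single_apply] at this

theorem polyComp_quadQ (g : SO4) : polyComp g quadQ = quadQ := by
  let X' : Fin 4 → MvPolynomial (Fin 4) ℂ := MvPolynomial.X
  let φ : ℝ →+* MvPolynomial (Fin 4) ℂ := C.comp (algebraMap ℝ ℂ)
  let M : Matrix (Fin 4) (Fin 4) (MvPolynomial (Fin 4) ℂ) := (g : Matrix (Fin 4) (Fin 4) ℝ).map φ
  have hQ : quadQ = X' ⬝ᵥ X' := by simp [quadQ, X', dotProduct, pow_two]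
  have hg : M.transpose * M = 1 := by
    have h : (g : Matrix (Fin 4) (Fin 4) ℝ).transpose * (g : Matrix (Fin 4) (Fin 4) ℝ) = 1 :=
      (Matrix.mem_orthogonalGroup_iff' _ _).1 (Matrix.mem_specialOrthogonalGroup_iff.1 g.2).1
    rw [← Matrix.transpose_map, ← Matrix.map_mul, h]
    simp
  have h1 : polyComp g quadQ = M.mulVec X' ⬝ᵥ M.mulVec X' := by
    simp [quadQ, polyComp, dotProduct, Matrix.mulVec, pow_two, M, X', φ]
  rw [h1, Matrix.dotProduct_mulVec, Matrix.vecMul_mulVec, hg, hQ, Matrix.vecMul_one]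

theorem quadQ_pow_mem_invariants (G : Subgroup SO4) (k : ℕ) :
    quadQ ^ k ∈ invariants G (2 * k) :=
  ⟨isHomogeneous_quadQ.pow k, fun g _ => by rw [map_pow, polyComp_quadQ]⟩

theorem invariants_eq_span_quadQ_pow {G : Subgroup SO4} {k : ℕ}
    (h : Module.finrank ℂ (invariants G (2 * k)) = 1) :
    invariants G (2 * k) = Submodule.span ℂ {quadQ ^ k} := by
  refine (Submodule.eq_of_le_of_finrank_eq ?_ ?_).symm
  · rw [Submodule.span_singleton_le_iff_mem]
    exact quadQ_pow_mem_invariants G k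
  · rw [h, finrank_span_singleton (pow_ne_zero k quadQ_ne_zero)]

/-- Any invariant of degree `2 m` outside the line of `Q ^ m` serves as the second one. -/
theorem exists_second_invariant {G : Subgroup SO4} {m : ℕ}
    (h : Module.finrank ℂ (invariants G (2 * m)) = 2) :
    ∃ S : MvPolynomial (Fin 4) ℂ, AlgebraicIndependent ℂ ![quadQ, S] ∧
      LinearIndependent ℂ ![quadQ ^ m, S] ∧
      invariants G (2 * m) = Submodule.span ℂ {quadQ ^ m, S} := by
  have hQ := quadQ_pow_mem_invariants G m
  have hQ0 : quadQ ^ m ≠ 0 := pow_ne_zero m quadQ_ne_zero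
  have hlt : Submodule.span ℂ {quadQ ^ m} < invariants G (2 * m) := by
    refine lt_of_le_of_ne ((Submodule.span_singleton_le_iff_mem _ _).2 hQ) fun heq => ?_
    rw [← heq, finrank_span_singleton hQ0] at h
    omega
  obtain ⟨S, hS, hSQ⟩ := SetLike.exists_of_lt hlt
  have hli : LinearIndependent ℂ ![quadQ ^ m, S] :=
    (LinearIndependent.pair_iff' hQ0).2 fun c hc =>
      hSQ (Submodule.mem_span_singleton.2 ⟨c, hc⟩)
  refine ⟨S, algebraicIndependent_pair_of_isHomogeneous two_pos quadQ_ne_zero isHomogeneous_quadQ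
    hS.1 hli, hli, ?_⟩
  refine (Submodule.eq_of_le_of_finrank_eq ?_ ?_).symm
  · rw [Submodule.span_le]
    rintro _ (rfl | rfl)
    exacts [hQ, hS]
  · have := finrank_span_eq_card hli
    rw [Matrix.range_cons, Matrix.range_cons, Matrix.range_empty, Set.union_empty,
      Set.singleton_union] at this
    rw [h, this, Fintype.card_fin]

theorem invariants_up_to_second {G : Subgroup SO4} {m : ℕ}
    (h1 : ∀ k < m, Module.finrank ℂ (invariants G (2 * k)) = 1)
    (h2 : Module.finrank ℂ (invariants G (2 * m)) = 2) :
    (∀ j < 2 * m, Even j → invariants G j = Submodule.span ℂ {quadQ ^ (j / 2)}) ∧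
      ∃ S : MvPolynomial (Fin 4) ℂ, AlgebraicIndependent ℂ ![quadQ, S] ∧
        LinearIndependent ℂ ![quadQ ^ (2 * m / 2), S] ∧
        invariants G (2 * m) = Submodule.span ℂ {quadQ ^ (2 * m / 2), S} := by
  constructor
  · intro j hj hje
    obtain ⟨k, rfl⟩ := even_iff_two_dvd.1 hje
    rw [Nat.mul_div_cancel_left k two_pos, invariants_eq_span_quadQ_pow (h1 k (by omega))]
  · rw [Nat.mul_div_cancel_left m two_pos]
    exact exists_second_invariant h2

theorem finrank_invariants_group6 (k : Fin 8) :
    Module.finrank ℂ (invariants group6 (2 * (k : ℕ))) = ![1, 1, 1, 2, 3, 3, 7, 8] k :=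
  finrank_invariants_biGroup_of_values tetrahedral chebAverage_tetrahedral_values (by decide) k

theorem finrank_invariants_group8 (k : Fin 8) :
    Module.finrank ℂ (invariants group8 (2 * (k : ℕ))) = ![1, 1, 1, 1, 2, 2, 3, 3] k :=
  finrank_invariants_biGroup_of_values octahedral chebAverage_octahedral_values (by decide) k

theorem finrank_invariants_group12 (k : Fin 8) :
    Module.finrank ℂ (invariants group12 (2 * (k : ℕ))) = ![1, 1, 1, 1, 1, 1, 2, 2] k :=
  finrank_invariants_biGroup_of_values icosahedral chebAverage_icosahedral_values (by decide) k

end SecondInvariant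

end Bipolyhedral

end

theorem mainTheorem3 :
    -- all four groups are finite and their Poincaré series is the Molien series
    (∀ G ∈ ({groupH, group6, group8, group12} : Set (Subgroup SO4)),
      Finite G ∧ poincareSeries G = molienSeries G) ∧
    -- the series modulo `t ^ 16`
    (PowerSeries.trunc 16 (molienSeries groupH) =
      1 + Polynomial.X ^ 2 + 5 * Polynomial.X ^ 4 + 6 * Polynomial.X ^ 6 +
        15 * Polynomial.X ^ 8 + 19 * Polynomial.X ^ 10 + 35 * Polynomial.X ^ 12 +
        44 * Polynomial.X ^ 14) ∧
    (PowerSeries.trunc 16 (molienSeries group6) =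
      1 + Polynomial.X ^ 2 + Polynomial.X ^ 4 + 2 * Polynomial.X ^ 6 +
        3 * Polynomial.X ^ 8 + 3 * Polynomial.X ^ 10 + 7 * Polynomial.X ^ 12 +
        8 * Polynomial.X ^ 14) ∧
    (PowerSeries.trunc 16 (molienSeries group8) =
      1 + Polynomial.X ^ 2 + Polynomial.X ^ 4 + Polynomial.X ^ 6 +
        2 * Polynomial.X ^ 8 + 2 * Polynomial.X ^ 10 + 3 * Polynomial.X ^ 12 +
        3 * Polynomial.X ^ 14) ∧
    (PowerSeries.trunc 16 (molienSeries group12) =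
      1 + Polynomial.X ^ 2 + Polynomial.X ^ 4 + Polynomial.X ^ 6 +
        Polynomial.X ^ 8 + Polynomial.X ^ 10 + 2 * Polynomial.X ^ 12 +
        2 * Polynomial.X ^ 14) ∧
    -- there are no nonzero invariants of odd degree
    (∀ G ∈ ({groupH, group6, group8, group12} : Set (Subgroup SO4)),
      ∀ j : ℕ, Odd j → invariants G j = ⊥) ∧
    -- below degree `n` only the powers of `Q`, and in degree `n` a second invariant
    (∀ nG ∈ ({(6, group6), (8, group8), (12, group12)} : Set (ℕ × Subgroup SO4)),
      (∀ j < nG.1, Even j → invariants nG.2 j = Submodule.span ℂ {quadQ ^ (j / 2)}) ∧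
      ∃ S : MvPolynomial (Fin 4) ℂ,
        AlgebraicIndependent ℂ ![quadQ, S] ∧
        LinearIndependent ℂ ![quadQ ^ (nG.1 / 2), S] ∧
        invariants nG.2 nG.1 = Submodule.span ℂ {quadQ ^ (nG.1 / 2), S}) := by
  refine ⟨?_, trunc_molienSeries_groupH, trunc_molienSeries_group6, trunc_molienSeries_group8,
    trunc_molienSeries_group12, ?_, ?_⟩
  · have h (K : Subgroup SO3) [Finite (K.comap rho)] :
        Finite (biGroup K) ∧ poincareSeries (biGroup K) = molienSeries (biGroup K) :=
      have := finite_biGroup K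
      ⟨this, poincareSeries_eq_molienSeries _⟩
    rintro _ (rfl | rfl | rfl | rfl)
    exacts [h klein, h tetrahedral, h octahedral, h icosahedral]
  · rintro _ (rfl | rfl | rfl | rfl) j hj
    exacts [invariants_eq_bot_of_odd klein hj, invariants_eq_bot_of_odd tetrahedral hj,
      invariants_eq_bot_of_odd octahedral hj, invariants_eq_bot_of_odd icosahedral hj]
  · rintro _ (rfl | rfl | rfl)
    · refine invariants_up_to_second (m := 3) (fun k hk => ?_) (finrank_invariants_group6 3)
      interval_cases k
      exacts [finrank_invariants_group6 0, finrank_invariants_group6 1,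
        finrank_invariants_group6 2]
    · refine invariants_up_to_second (m := 4) (fun k hk => ?_) (finrank_invariants_group8 4)
      interval_cases k
      exacts [finrank_invariants_group8 0, finrank_invariants_group8 1,
        finrank_invariants_group8 2, finrank_invariants_group8 3]
    · refine invariants_up_to_second (m := 6) (fun k hk => ?_) (finrank_invariants_group12 6)
      interval_cases k
      exacts [finrank_invariants_group12 0, finrank_invariants_group12 1,
        finrank_invariants_group12 2, finrank_invariants_group12 3,
        finrank_invariants_group12 4, finrank_invariants_group12 5]
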